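/- Let $F$ be an arbitrary ordered field and $d\ge 2$ a natural number. For $p,q\in F^d$ put $\mathsf{d}^2(p,q)=\sum_{i=1}^d (p_i-q_i)^2$ and $\mathsf{d}_\mu^2(p,q)=(p_1-q_1)^2-\sum_{i=2}^d (p_i-q_i)^2$. Consider the following relations on $F^d$: - $\mathsf{Bw}(p,q,r)$ iff $q=p+t(r-p)$ for some $t\in F$ with $0\le t\le 1$; - $p\,\mathsf{S}\,q$ iff $p_1=q_1$; - $p\,\mathsf{Rest}\,q$ iff $p_i=q_i$ for all $i\ge 2$; - $p\,\lambda\,q$ iff $(p_1-q_1)^2=\sum_{i=2}^d(p_i-q_i)^2$; - $(p,q)\equiv(r,s)$ iff $\mathsf{d}^2(p,q)=\mathsf{d}^2(r,s)$; - $(p,q)\equiv_\mu(r,s)$ iff $\mathsf{d}_\mu^2(p,q)=\mathsf{d}_\mu^2(r,s)$; - $(p,q)\equiv_{\mathsf{S}}(r,s)$ iff $(p,q)\equiv(r,s)$ and $p\,\mathsf{S}\,q$ and $r\,\mathsf{S}\,s$; - $\delta(p,q,r)$ iff $p\,\mathsf{S}\,q$ and $p\,\lambda\,r$. For a first-order structure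 $\mathcal{G}$, let $\mathrm{C}(\mathcal{G})$ (the set of its concepts) be the set of all finitary relations on its universe that are definable in $\mathcal{G}$ by a first-order formula without parameters. Two structures $\mathcal{G},\mathcal{H}$ on the same universe are called definitionally equivalent if $\mathrm{C}(\mathcal{G})=\mathrm{C}(\mathcal{H})$. Write $\langle\mathcal{G},\mathsf{R}\rangle$ for the expansion of $\mathcal{G}$ by the relation $\mathsf{R}$. Let $$\mathit{OAff}=\langle F^d,\mathsf{Bw}\rangle,\quad \mathit{Eucl}=\langle F^d,\equiv,\mathsf{Bw}\rangle,\quad \mathit{Rel}=\langle F^d,\lambda,\mathsf{Bw}\rangle,\quad \mathit{Gal}=\langle F^d,\equiv_{\mathsf{S}},\mathsf{Bw}\rangle,$$ $$\mathit{Newt}=\langle \mathit{Gal},\mathsf{Rest}\rangle,\qquad \mathit{LClass}=\langle \mathit{Gal},\lambda\rangle .$$ Let $\mathcal{K}=\{\equiv,\equiv_\mu,\lambda,\equiv_{\mathsf{S}},\mathsf{S},\mathsf{Rest},\delta\}$. The members of $\mathcal{K}$ that are concepts of these geometries are $$\mathcal{K}\cap \mathrm{C}(\mathit{Eucl})=\{\equiv\},\quad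 \mathcal{K}\cap \mathrm{C}(\mathit{Rel})=\{\equiv_\mu,\lambda\},\quad \mathcal{K}\cap \mathrm{C}(\mathit{Gal})=\{\equiv_{\mathsf{S}},\mathsf{S}\},\quad \mathcal{K}\cap \mathrm{C}(\mathit{Newt})=\{\equiv_{\mathsf{S}},\mathsf{S},\mathsf{Rest}\}.$$ Let $\mathcal{G}\in\{\mathit{Rel},\mathit{Eucl},\mathit{Gal},\mathit{Newt}\}$ and $\mathsf{R}\in\mathcal{K}$ with $\mathsf{R}\notin \mathrm{C}(\mathcal{G})$, and $\mathsf{R}\ne\mathsf{Rest}$ if $\mathcal{G}=\mathit{Gal}$. Then: 1. If $d\ge 3$, then $\langle\mathcal{G},\mathsf{R}\rangle$ is definitionally equivalent to $\mathit{LClass}$. 2. If $d=2$ and $(\mathcal{G},\mathsf{R})$ is none of $(\mathit{Eucl},\lambda)$, $(\mathit{Eucl},\equiv_\mu)$, $(\mathit{Rel},\equiv)$, then $\langle\mathcal{G},\mathsf{R}\rangle$ is definitionally equivalent to $\mathit{LClass}$. Moreover: 3. If $d=2$, then $\langle\mathit{Rel},\equiv\rangle$, $\langle\mathit{Eucl},\equiv_\mu\rangle$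 and $\langle\mathit{Eucl},\lambda\rangle$ are definitionally equivalent to one another, but none of them is definitionally equivalent to $\mathit{LClass}$. 4. $\langle\mathit{OAff},\delta\rangle$ is definitionally equivalent to $\mathit{LClass}$ (for every $d\ge 2$). -/

import Mathlib

universe u

namespace CoordGeom

/-- A finitary relation on `M`: an arity `n` together with an `n`-ary relation. -/
abbrev FinRel (M : Type u) : Type u := Σ n : ℕ, Set (Fin n → M)

/-- A first-order structure on the universe `M` without functions and constants, given by the
set of its basic relations. Each basic relation serves as its own relation symbol. -/
abbrev Model (M : Type u) : Type u := Set (FinRel M)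

namespace Model

variable {M : Type u}

/-- The first-order language of a model: one relation symbol for each basic relation, and no
function or constant symbols. -/
def lang (G : Model M) : FirstOrder.Language.{0, u} where
  Functions _ := Empty
  Relations n := {R : Set (Fin n → M) // (⟨n, R⟩ : FinRel M) ∈ G}

instance str (G : Model M) : G.lang.Structure M where
  funMap f := f.elim
  RelMap R x := x ∈ R.1

/-- The set of all concepts of a model: all finitary relations on its universe that are definable
in it by a first-order formula without parameters. -/
def concepts (G : Model M) : Set (FinRel M) :=
  {R | (∅ : Set M).Definable G.lang R.2}

/-- The expansion of `G` by the relation `R`. -/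
def expand (G : Model M) (R : FinRel M) : Model M := insert R G

/-- Two models on the same universe are definitionally equivalent iff they have the same
concepts. -/
def DefEquiv (G H : Model M) : Prop := G.concepts = H.concepts

end Model

section Relations

variable (F : Type u) [Field F] (d : ℕ)

/-- The points of `d`-dimensional coordinate geometry; the coordinate of index `0` is the time
component, and the other coordinates are the space components. -/
abbrev Point : Type u := Fin d → F

variable {F d} in
/-- The Euclidean scalar product. -/
def euclProd (p q : Point F d) : F := ∑ i, p i * q i

variable {F d} in
/-- The Minkowski product. -/
def minkProd (p q : Point F d) : F :=
  ∑ i : Fin d, if (i : ℕ) = 0 then p i * q i else -(p i * q i)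

variable {F d} in
/-- Squared Euclidean distance. -/
def sqDistE (p q : Point F d) : F := euclProd (p - q) (p - q)

variable {F d} in
/-- Squared Minkowski distance. -/
def sqDistM (p q : Point F d) : F := minkProd (p - q) (p - q)

variable {F d} in
/-- Two points are simultaneous: their time components agree. -/
def Simult (p q : Point F d) : Prop := ∀ i : Fin d, (i : ℕ) = 0 → p i = q i

variable {F d} in
/-- Two points are at rest relative to each other: their space components agree. -/
def AtRest (p q : Point F d) : Prop := ∀ i : Fin d, (i : ℕ) ≠ 0 → p i = q i

variable {F d} in
/-- Two points are lightlike related: the squared difference of their time components is the sum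
of the squared differences of their space components. -/
def Lightlike (p q : Point F d) : Prop :=
  ∀ i : Fin d, (i : ℕ) = 0 → (p i - q i) ^ 2 = ∑ j : Fin d with j.val ≠ 0, (p j - q j) ^ 2

/-- Absolute simultaneity. -/
def S : FinRel (Point F d) := ⟨2, {x | Simult (x 0) (x 1)}⟩

/-- Being at rest. -/
def Rest : FinRel (Point F d) := ⟨2, {x | AtRest (x 0) (x 1)}⟩

/-- Lightlike relatedness. -/
def lam : FinRel (Point F d) := ⟨2, {x | Lightlike (x 0) (x 1)}⟩

/-- Euclidean congruence. -/
def cong : FinRel (Point F d) := ⟨4, {x | sqDistE (x 0) (x 1) = sqDistE (x 2) (x 3)}⟩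

/-- Minkowski congruence. -/
def congMu : FinRel (Point F d) := ⟨4, {x | sqDistM (x 0) (x 1) = sqDistM (x 2) (x 3)}⟩

/-- Congruence on simultaneity. -/
def congS : FinRel (Point F d) :=
  ⟨4, {x | sqDistE (x 0) (x 1) = sqDistE (x 2) (x 3) ∧ Simult (x 0) (x 1) ∧ Simult (x 2) (x 3)}⟩

/-- The ternary relation combining simultaneity and lightlike relatedness. -/
def delta : FinRel (Point F d) := ⟨3, {x | Simult (x 0) (x 1) ∧ Lightlike (x 0) (x 2)}⟩

/-- The seven relations by which geometries are expanded. -/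
def keyRelations : Set (FinRel (Point F d)) :=
  {cong F d, congMu F d, lam F d, congS F d, S F d, Rest F d, delta F d}

variable [LinearOrder F]

/-- Betweenness. -/
def Bw : FinRel (Point F d) :=
  ⟨3, {x | ∃ l : F, 0 ≤ l ∧ l ≤ 1 ∧ x 1 = x 0 + l • (x 2 - x 0)}⟩

/-- Ordered affine geometry. -/
def OAff : Model (Point F d) := {Bw F d}

/-- Euclidean geometry. -/
def Eucl : Model (Point F d) := {cong F d, Bw F d}

/-- Relativistic spacetime. -/
def Rel : Model (Point F d) := {lam F d, Bw F d}

/-- Galilean spacetime. -/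
def Gal : Model (Point F d) := {congS F d, Bw F d}

/-- Newtonian spacetime. -/
def Newt : Model (Point F d) := (Gal F d).expand (Rest F d)

/-- Late classical spacetime. -/
def LClass : Model (Point F d) := (Gal F d).expand (lam F d)

end Relations

end CoordGeom

/-!
All geometries here contain betweenness, and all their basic relations are invariant under
translations. Betweenness defines nondegenerate parallelograms (`pgram_iff`), and through them
vector addition relative to an origin (`add_eq_iff_pgram`). Since the origin may be replaced by an
arbitrary point (`Model.TransInv.mem_concepts`), a translation invariant relation is a concept as
soon as it is definable from the origin, addition, collinearity and the given relations. So
everything becomes linear algebra of the Euclidean form `t t' + ⟨x, x'⟩` and the Minkowski form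
`t t' - ⟨x, x'⟩`: congruence for a form is interdefinable with orthogonality for it, because `v` and
`w` have the same length exactly if `v + w` and `v - w` are orthogonal.

Lightlike relatedness defines Minkowski orthogonality over every ordered field
(`orth_iff_iterSum`). For a non-null vector `w`, a line parallel to `w` that meets the null cone
twice does so in mirror images, whose sum is orthogonal to `w`. Because every vector is a sum of
`2 d` null vectors, the orthogonal complement of `w` consists of the sums of `2 d` such vectors and
of null vectors orthogonal to `w`. No square roots are needed.

With this, simultaneity and lightlike relatedness define all key relations: the time axis is the
orthogonal complement of the space of simultaneity, and the Euclidean form is the Minkowski form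
composed with the reflection in the time axis. Hence an expansion is definitionally equivalent to
late classical spacetime once it defines these two relations (`defEquiv_LClass`). The only case in
which simultaneity is not immediate is that of the Euclidean and the Minkowski form together. Their
common eigenvectors, the vectors with the same orthogonal complement for both forms, are the
temporal and the spatial ones, and in dimension at least three the spatial ones are those whose
eigenspace is not a line (`spatial_iff_eigen`). In dimension two, time and space can be exchanged.

That a relation is not a concept is shown by automorphisms acting on one coordinate plane: a
rotation, a Lorentz boost, a Galilean boost, a change of the unit of time, and the exchange of the
two axes, all with rational coefficients.
-/

/-! ### Definability in a model -/

namespace CoordGeom.Model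

open FirstOrder FirstOrder.Language

universe v

section Logic

variable {M : Type v} {G H : Model M} {A : Set M} {α : Type*}

/-- The predicate `P` on assignments of points to the variables in `α` is definable in `G` by a
first-order formula with parameters from `A`. -/
def Dfn (G : Model M) (A : Set M) (P : (α → M) → Prop) : Prop := A.Definable G.lang {x | P x}

theorem Dfn.congr {P Q : (α → M) → Prop} (hP : G.Dfn A P) (h : ∀ x, Q x ↔ P x) : G.Dfn A Q := by
  have : Q = P := funext fun x => propext (h x)
  rwa [this]

theorem Dfn.and {P Q : (α → M) → Prop} (hP : G.Dfn A P) (hQ : G.Dfn A Q) :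
    G.Dfn A fun x => P x ∧ Q x :=
  Set.Definable.inter hP hQ

theorem Dfn.or {P Q : (α → M) → Prop} (hP : G.Dfn A P) (hQ : G.Dfn A Q) :
    G.Dfn A fun x => P x ∨ Q x :=
  Set.Definable.union hP hQ

theorem Dfn.not {P : (α → M) → Prop} (hP : G.Dfn A P) : G.Dfn A fun x => ¬ P x :=
  Set.Definable.compl hP

theorem Dfn.imp {P Q : (α → M) → Prop} (hP : G.Dfn A P) (hQ : G.Dfn A Q) :
    G.Dfn A fun x => P x → Q x :=
  (hP.not.or hQ).congr fun _ => imp_iff_not_or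

theorem Dfn.iff {P Q : (α → M) → Prop} (hP : G.Dfn A P) (hQ : G.Dfn A Q) :
    G.Dfn A fun x => P x ↔ Q x :=
  ((hP.imp hQ).and (hQ.imp hP)).congr fun _ => iff_iff_implies_and_implies

/-- In the hypothesis the bound variable has become an additional free variable `Sum.inr 0`. -/
theorem Dfn.ex {P : (α → M) → M → Prop}
    (hP : G.Dfn A fun z : α ⊕ Fin 1 → M => P (fun a => z (Sum.inl a)) (z (Sum.inr 0))) :
    G.Dfn A fun x => ∃ y, P x y := by
  refine Dfn.congr (Set.Definable.exists_of_finite hP) fun x => ⟨?_, ?_⟩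
  · rintro ⟨y, hy⟩
    exact ⟨fun _ => y, hy⟩
  · rintro ⟨u, hu⟩
    exact ⟨u 0, hu⟩

theorem Dfn.all {P : (α → M) → M → Prop}
    (hP : G.Dfn A fun z : α ⊕ Fin 1 → M => P (fun a => z (Sum.inl a)) (z (Sum.inr 0))) :
    G.Dfn A fun x => ∀ y, P x y :=
  (Dfn.ex (P := fun x y => ¬ P x y) hP.not).not.congr fun _ => not_exists_not.symm

theorem definableFun_var (i : α) : A.DefinableFun G.lang fun x => x i := .proj _

theorem Dfn.eq {f g : (α → M) → M} (hf : A.DefinableFun G.lang f) (hg : A.DefinableFun G.lang g) :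
    G.Dfn A fun x => f x = g x :=
  hf.ofPred_eq hg

/-- Definability of a unary relation. -/
def Dfn1 (G : Model M) (A : Set M) (Q : M → Prop) : Prop := G.Dfn A fun x : Fin 1 → M => Q (x 0)

/-- Definability of a binary relation. -/
def Dfn2 (G : Model M) (A : Set M) (Q : M → M → Prop) : Prop :=
  G.Dfn A fun x : Fin 2 → M => Q (x 0) (x 1)

/-- Definability of a ternary relation. -/
def Dfn3 (G : Model M) (A : Set M) (Q : M → M → M → Prop) : Prop :=
  G.Dfn A fun x : Fin 3 → M => Q (x 0) (x 1) (x 2)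

/-- Definability of a quaternary relation. -/
def Dfn4 (G : Model M) (A : Set M) (Q : M → M → M → M → Prop) : Prop :=
  G.Dfn A fun x : Fin 4 → M => Q (x 0) (x 1) (x 2) (x 3)

variable {f g h k : (α → M) → M}

theorem Dfn1.comp {Q : M → Prop} (hQ : G.Dfn1 A Q) (hf : A.DefinableFun G.lang f) :
    G.Dfn A fun x => Q (f x) :=
  Set.Definable.preimage_map (F := fun x => ![f x]) (by simpa [Set.DefinableMap] using hf) hQ

theorem Dfn2.comp {Q : M → M → Prop} (hQ : G.Dfn2 A Q) (hf : A.DefinableFun G.lang f)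
    (hg : A.DefinableFun G.lang g) : G.Dfn A fun x => Q (f x) (g x) :=
  Set.Definable.preimage_map (F := fun x => ![f x, g x])
    (by simpa [Set.DefinableMap, Fin.forall_fin_succ] using ⟨hf, hg⟩) hQ

theorem Dfn3.comp {Q : M → M → M → Prop} (hQ : G.Dfn3 A Q) (hf : A.DefinableFun G.lang f)
    (hg : A.DefinableFun G.lang g) (hh : A.DefinableFun G.lang h) :
    G.Dfn A fun x => Q (f x) (g x) (h x) :=
  Set.Definable.preimage_map (F := fun x => ![f x, g x, h x])
    (by simpa [Set.DefinableMap, Fin.forall_fin_succ] using ⟨hf, hg, hh⟩) hQ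

theorem Dfn4.comp {Q : M → M → M → M → Prop} (hQ : G.Dfn4 A Q) (hf : A.DefinableFun G.lang f)
    (hg : A.DefinableFun G.lang g) (hh : A.DefinableFun G.lang h)
    (hk : A.DefinableFun G.lang k) : G.Dfn A fun x => Q (f x) (g x) (h x) (k x) :=
  Set.Definable.preimage_map (F := fun x => ![f x, g x, h x, k x])
    (by simpa [Set.DefinableMap, Fin.forall_fin_succ] using ⟨hf, hg, hh, hk⟩) hQ

theorem dfn_of_mem_concepts {n : ℕ} {R : Set (Fin n → M)} (hR : (⟨n, R⟩ : FinRel M) ∈ G.concepts) :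
    G.Dfn A fun x => x ∈ R :=
  Set.Definable.mono hR (Set.empty_subset A)

/-- An operation with a definable graph yields definable functions from definable functions. -/
theorem definableFun_of_dfn3 {op : M → M → M} (hop : G.Dfn3 A fun a b c => op a b = c)
    (hf : A.DefinableFun G.lang f) (hg : A.DefinableFun G.lang g) :
    A.DefinableFun G.lang fun x => op (f x) (g x) := by
  have h1 : A.DefinableFun G.lang fun x : Fin 2 → M => op (x 0) (x 1) :=
    hop.comp (f := fun z : Option (Fin 2) → M => z (some 0)) (g := fun z => z (some 1))
      (h := fun z => z none) (.proj _) (.proj _) (.proj _)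
  exact Set.DefinableFun.comp (g := fun x => ![f x, g x])
    (by simpa [Set.DefinableMap, Fin.forall_fin_succ] using ⟨hf, hg⟩) h1

/-! ### Concepts, expansions and automorphisms -/

theorem mem_concepts_of_mem {R : FinRel M} (hR : R ∈ G) : R ∈ G.concepts := by
  have key (r : G.lang.Relations R.1) :
      (∅ : Set M).Definable G.lang {x : Fin R.1 → M | Structure.RelMap r x} :=
    Set.empty_definable_iff.2 ⟨r.formula fun i => Term.var i, by ext; simp⟩
  exact key ⟨R.2, hR⟩

theorem definableFun_realize_term {n : ℕ} (t : H.lang.Term (α ⊕ Fin n)) :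
    A.DefinableFun G.lang fun v => t.realize v := by
  cases t with
  | var i => exact .proj _
  | func f _ => exact f.elim

/-- Replacing the relation symbols of `H` by formulas of `G` turns a formula of `H` into one
of `G`. -/
theorem dfn_realize_of_subset_concepts (hHG : H ⊆ G.concepts) {n : ℕ}
    (φ : H.lang.BoundedFormula α n) :
    G.Dfn ∅ fun v : α ⊕ Fin n → M => φ.Realize (v ∘ Sum.inl) (v ∘ Sum.inr) := by
  induction φ with
  | falsum => exact Set.definable_empty
  | equal t₁ t₂ =>
    simp only [BoundedFormula.Realize, Sum.elim_comp_inl_inr]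
    exact Dfn.eq (definableFun_realize_term t₁) (definableFun_realize_term t₂)
  | rel R ts =>
    simp only [BoundedFormula.Realize, Sum.elim_comp_inl_inr]
    exact Set.Definable.preimage_map (F := fun v i => (ts i).realize v)
      (fun i => definableFun_realize_term (ts i)) (hHG R.2)
  | imp φ ψ h₁ h₂ => exact h₁.imp h₂
  | @all n φ h =>
    refine Dfn.all (P := fun v a => φ.Realize (v ∘ Sum.inl) (Fin.snoc (v ∘ Sum.inr) a)) ?_
    refine Dfn.congr (Set.Definable.preimage_comp (β := (α ⊕ Fin n) ⊕ Fin 1)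
      (Sum.elim (fun a => Sum.inl (Sum.inl a))
        (Fin.snoc (α := fun _ => (α ⊕ Fin n) ⊕ Fin 1)
          (fun i => Sum.inl (Sum.inr i)) (Sum.inr 0))) h) fun z => ?_
    refine iff_of_eq (congrArg₂ _ rfl ?_)
    ext i
    refine Fin.lastCases ?_ (fun j => ?_) i <;> simp

/-- Everything definable from concepts of `G` is a concept of `G`. -/
theorem concepts_subset_of_subset (hHG : H ⊆ G.concepts) : H.concepts ⊆ G.concepts := by
  intro R hR
  obtain ⟨φ, hφ⟩ := Set.empty_definable_iff.1 hR
  have h := Set.Definable.preimage_comp (Sum.elim id Fin.elim0 : Fin R.1 ⊕ Fin 0 → Fin R.1)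
    (dfn_realize_of_subset_concepts hHG φ)
  refine Dfn.congr (Q := fun x => x ∈ R.2) h fun x => (Set.ext_iff.1 hφ x).trans ?_
  exact iff_of_eq (congrArg (BoundedFormula.Realize φ x) (Subsingleton.elim _ _))

theorem concepts_mono (h : H ⊆ G) : H.concepts ⊆ G.concepts :=
  concepts_subset_of_subset fun _ hR => mem_concepts_of_mem (h hR)

theorem defEquiv_of_subset (h₁ : G ⊆ H.concepts) (h₂ : H ⊆ G.concepts) : G.DefEquiv H :=
  Set.Subset.antisymm (concepts_subset_of_subset h₁) (concepts_subset_of_subset h₂)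

theorem expand_subset {R : FinRel M} {K : Set (FinRel M)} (hG : G ⊆ K) (hR : R ∈ K) :
    G.expand R ⊆ K :=
  Set.insert_subset hR hG

theorem mem_concepts_expand {R : FinRel M} : R ∈ (G.expand R).concepts := mem_concepts_of_mem (Or.inl rfl)

theorem concepts_subset_expand {R : FinRel M} : G.concepts ⊆ (G.expand R).concepts :=
  concepts_mono fun _ h => Or.inr h

/-- The permutation `e` is an automorphism of the model. -/
def Preserves (G : Model M) (e : M ≃ M) : Prop :=
  ∀ R ∈ G, ∀ x : Fin R.1 → M, e ∘ x ∈ R.2 ↔ x ∈ R.2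

theorem Preserves.realize_iff {e : M ≃ M} (he : G.Preserves e) (φ : G.lang.Formula α)
    (x : α → M) : φ.Realize (e ∘ x) ↔ φ.Realize x := by
  let e' : G.lang.Equiv M M :=
    { e with
      map_fun' := fun f => f.elim
      map_rel' := fun R x => he _ R.2 x }
  exact StrongHomClass.realize_formula e' φ

/-- Concepts are invariant under automorphisms. -/
theorem Preserves.mem_iff {e : M ≃ M} (he : G.Preserves e) {R : FinRel M} (hR : R ∈ G.concepts)
    (x : Fin R.1 → M) : e ∘ x ∈ R.2 ↔ x ∈ R.2 := by
  obtain ⟨φ, hφ⟩ := Set.empty_definable_iff.1 hR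
  rw [hφ]
  exact he.realize_iff φ x

end Logic

section Translation

variable {M : Type v} [AddGroup M] {G : Model M}

theorem definableFun_zero {α : Type*} : Set.DefinableFun G.lang {0} fun _ : α → M => 0 :=
  FirstOrder.Language.definableFun_const _ _ rfl

/-- Every translation is an automorphism of the model. -/
def TransInv (G : Model M) : Prop := ∀ a : M, G.Preserves (Equiv.addRight a)

/-- In a translation invariant model the origin is dispensable as a parameter in definitions of
translation invariant relations: an arbitrary point takes its place. -/
theorem TransInv.mem_concepts (hG : G.TransInv) {R : FinRel M}
    (hR : G.Dfn {0} fun x => x ∈ R.2)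
    (hinv : ∀ (a : M) (x : Fin R.1 → M), (fun i => x i + a) ∈ R.2 ↔ x ∈ R.2) :
    R ∈ G.concepts := by
  obtain ⟨φ, hφ⟩ := Set.definable_iff_exists_formula_sum.1 hR
  have key : ∀ o (x : Fin R.1 → M), φ.Realize (Sum.elim (fun _ => o) x) ↔ x ∈ R.2 := by
    intro o x
    rw [← (hG (-o)).realize_iff, ← hinv (-o)]
    have h2 := Set.ext_iff.1 hφ fun i => x i + -o
    refine Iff.trans (iff_of_eq (congrArg _ ?_)) h2.symm
    ext i
    rcases i with ⟨i, hi⟩ | i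
    · obtain rfl : i = 0 := hi
      simp
    · simp
  have h0 : G.Dfn ∅ fun x : _ → M => φ.Realize x := Set.empty_definable_iff.2 ⟨φ, rfl⟩
  have h1 := Set.Definable.preimage_comp (β := Fin R.1 ⊕ Fin 1)
    (Sum.elim (fun _ => Sum.inr 0) Sum.inl) h0
  refine Dfn.congr (Dfn.ex (P := fun x o => φ.Realize (Sum.elim (fun _ => o) x))
    (Dfn.congr h1 fun z => iff_of_eq (congrArg _ ?_))) fun x => ?_
  · ext i
    rcases i with i | i <;> rfl
  · simp only [key]
    exact ⟨fun h => ⟨0, h⟩, fun ⟨_, h⟩ => h⟩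

end Translation

end CoordGeom.Model

/-! ### Parallelograms and vector addition from betweenness -/

namespace CoordGeom

open Model

universe v

section Affine

variable {F : Type u} [Field F] [LinearOrder F]
  {V : Type v} [AddCommGroup V] [Module F V]

variable (F) in
/-- Betweenness in a vector space. -/
def Btw (p q r : V) : Prop := ∃ l : F, 0 ≤ l ∧ l ≤ 1 ∧ q = p + l • (r - p)

variable (F) in
/-- For `p ≠ q`: the point `x` is on the line through `p` and `q`. -/
def OnLine (p q x : V) : Prop := Btw F p x q ∨ Btw F p q x ∨ Btw F x p q

variable (F) in
/-- The points `a`, `b`, `d`, `c` are the consecutive vertices of a nondegenerate parallelogram: opposite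
sides lie on disjoint lines and the diagonals meet. That the diagonals meet makes the four points
coplanar. -/
def Pgram (a b c d : V) : Prop :=
  b ≠ a ∧ ¬ OnLine F a b c ∧ (¬ ∃ x, OnLine F a b x ∧ OnLine F c d x) ∧
    (¬ ∃ x, OnLine F a c x ∧ OnLine F b d x) ∧ ∃ x, Btw F a x d ∧ Btw F b x c

variable [IsStrictOrderedRing F]

theorem onLine_of_smul (p q : V) (s : F) : OnLine F p q (p + s • (q - p)) := by
  rcases lt_or_ge s 0 with h | h
  · have h1 : (0 : F) < 1 - s := by linarith
    refine Or.inr (Or.inr ⟨-s / (1 - s), div_nonneg (by linarith) h1.le, ?_, ?_⟩)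
    · rw [div_le_one h1]; linarith
    · match_scalars <;> field_simp <;> ring
  · rcases le_or_gt s 1 with h' | h'
    · exact Or.inl ⟨s, h, h', rfl⟩
    · have h1 : 0 < s := by linarith
      refine Or.inr (Or.inl ⟨s⁻¹, by positivity, inv_le_one_of_one_le₀ h'.le, ?_⟩)
      match_scalars <;> field_simp
      ring

theorem onLine_iff {p q x : V} (hpq : q ≠ p) : OnLine F p q x ↔ ∃ s : F, x = p + s • (q - p) := by
  refine ⟨?_, by rintro ⟨s, rfl⟩; exact onLine_of_smul p q s⟩
  rintro (⟨l, -, -, h⟩ | ⟨l, -, -, h⟩ | ⟨l, -, -, h⟩)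
  · exact ⟨l, h⟩
  · have hl : l ≠ 0 := by
      rintro rfl
      exact hpq (by simpa using h)
    refine ⟨l⁻¹, ?_⟩
    rw [h, add_sub_cancel_left, smul_smul, inv_mul_cancel₀ hl]
    module
  · have hl : 1 - l ≠ 0 := by
      intro h0
      obtain rfl : l = 1 := by linear_combination -h0
      exact hpq (by rw [h]; module)
    refine ⟨-l / (1 - l), ?_⟩
    have h2 : (1 - l) • x = (1 - l) • (p + (-l / (1 - l)) • (q - p)) := by
      rw [smul_add, smul_smul, mul_div_cancel₀ _ hl]
      linear_combination (norm := module) -h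
    exact (smul_right_injective V hl) h2

/-- Both coordinates of `d` in the affine frame `a`, `b`, `c` are `1`: otherwise opposite sides
would lie on intersecting lines. -/
theorem pgram_iff {a b c d : V} :
    Pgram F a b c d ↔ b ≠ a ∧ (∀ s : F, c ≠ a + s • (b - a)) ∧ d = b + c - a := by
  constructor
  · rintro ⟨hba, hc, h1, h2, x, ⟨s, -, -, hx⟩, ⟨t, -, -, hx'⟩⟩
    rw [onLine_iff hba, not_exists] at hc
    refine ⟨hba, hc, ?_⟩
    have hs : s ≠ 0 := by
      rintro rfl
      rcases eq_or_ne t 0 with rfl | ht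
      · exact hba (by simpa using hx'.symm.trans hx)
      · refine hc (1 - t⁻¹) ?_
        have h3 : t⁻¹ • (b + t • (c - b)) = t⁻¹ • a := by rw [← hx', hx]; simp
        rw [smul_add, smul_smul, inv_mul_cancel₀ ht] at h3
        linear_combination (norm := module) h3
    obtain ⟨X, hX⟩ : ∃ X, X = (1 - t) / s := ⟨_, rfl⟩
    obtain ⟨Y, hY⟩ : ∃ Y, Y = t / s := ⟨_, rfl⟩
    -- the coordinates of `d` in the affine frame `a, b, c`
    have hd : d = a + X • (b - a) + Y • (c - a) := by
      have h3 : s⁻¹ • (a + s • (d - a)) = s⁻¹ • (b + t • (c - b)) := by rw [← hx', hx]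
      rw [smul_add, smul_smul, inv_mul_cancel₀ hs] at h3
      have h4 : d = a - s⁻¹ • a + s⁻¹ • (b + t • (c - b)) := by
        linear_combination (norm := module) h3
      rw [h4, hX, hY]
      match_scalars <;> field_simp <;> ring
    have hY1 : Y = 1 := by
      by_contra hne
      have hne' : 1 - Y ≠ 0 := fun h => hne (by linear_combination -h)
      refine h1 ⟨a + ((1 - Y)⁻¹ * X) • (b - a), onLine_of_smul _ _ _, ?_⟩
      convert onLine_of_smul c d (1 - Y)⁻¹ using 1
      rw [hd]
      match_scalars <;> field_simp <;> ring
    have hX1 : X = 1 := by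
      by_contra hne
      have hne' : 1 - X ≠ 0 := fun h => hne (by linear_combination -h)
      refine h2 ⟨a + ((1 - X)⁻¹ * Y) • (c - a), onLine_of_smul _ _ _, ?_⟩
      convert onLine_of_smul b d (1 - X)⁻¹ using 1
      rw [hd]
      match_scalars <;> field_simp <;> ring
    rw [hd, hX1, hY1]
    module
  · rintro ⟨hba, hc, rfl⟩
    have hca : c ≠ a := by simpa using hc 0
    have hdc : b + c - a ≠ c := fun h => hba (by linear_combination (norm := module) h)
    have hdb : b + c - a ≠ b := fun h => hca (by linear_combination (norm := module) h)
    refine ⟨hba, ?_, ?_, ?_, a + (2⁻¹ : F) • (b + c - a - a),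
      ⟨2⁻¹, by positivity, by norm_num, rfl⟩, ⟨2⁻¹, by positivity, by norm_num, ?_⟩⟩
    · rw [onLine_iff hba, not_exists]
      exact hc
    · rintro ⟨x, h1, h2⟩
      rw [onLine_iff hba] at h1
      rw [onLine_iff hdc] at h2
      obtain ⟨s, rfl⟩ := h1
      obtain ⟨k, hk⟩ := h2
      exact hc (s - k) (by linear_combination (norm := module) -hk)
    · rintro ⟨x, h1, h2⟩
      rw [onLine_iff hca] at h1
      rw [onLine_iff hdb] at h2
      obtain ⟨s, rfl⟩ := h1
      obtain ⟨k, hk⟩ := h2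
      have h3 : b - a = (s - k) • (c - a) := by linear_combination (norm := module) -hk
      rcases eq_or_ne (s - k) 0 with h0 | h0
      · rw [h0, zero_smul, sub_eq_zero] at h3
        exact hba h3
      · refine hc (s - k)⁻¹ ?_
        rw [h3, smul_smul, inv_mul_cancel₀ h0]
        module
    · match_scalars <;> ring

/-- The translation taking `0` to `x` is carried over from the side `0, x` of a parallelogram
to the opposite side, and from there to the side `y, z` of a second one. -/
theorem add_eq_iff_pgram (hV : ∀ x : V, ∃ w, ∀ s : F, w ≠ s • x) (x y z : V) :
    x + y = z ↔ (x = 0 ∧ y = z) ∨ (x ≠ 0 ∧ ∃ e f, Pgram F 0 x e f ∧ Pgram F e f y z) := by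
  simp only [pgram_iff]
  constructor
  · rintro rfl
    rcases eq_or_ne x 0 with rfl | hx
    · simp
    refine Or.inr ⟨hx, ?_⟩
    obtain ⟨w, hw⟩ := hV x
    have hw' : ∀ s : F, -w ≠ s • x := fun s h => hw (-s) (by rw [neg_smul, ← h, neg_neg])
    have key : ∃ e, (∀ s : F, e ≠ s • x) ∧ ∀ s : F, y ≠ e + s • x := by
      by_contra! hcon
      obtain ⟨s, hs⟩ := hcon w hw
      obtain ⟨t, ht⟩ := hcon (-w) hw'
      refine hw (2⁻¹ * (t - s)) ?_
      have h2 : (2 : F) • w = (t - s) • x := by linear_combination (norm := module) ht - hs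
      rw [mul_smul, ← h2, smul_smul]
      norm_num
    obtain ⟨e, he, hy⟩ := key
    refine ⟨e, x + e, ⟨hx, fun s => by simpa using he s, by simp⟩, by simpa using hx,
      fun s => by simpa using hy s, by abel⟩
  · rintro (⟨rfl, rfl⟩ | ⟨hx, e, f, ⟨-, -, rfl⟩, -, -, rfl⟩)
    · simp
    · abel

theorem parallel_iff_onLine (u w : V) :
    (∃ s : F, w = s • u) ↔ w = 0 ∨ (u ≠ 0 ∧ OnLine F 0 u w) := by
  rcases eq_or_ne u 0 with rfl | hu
  · simp
  · rw [onLine_iff hu]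
    simp only [zero_add, sub_zero, ne_eq, hu, not_false_eq_true, true_and]
    exact ⟨Or.inr, by rintro (rfl | h); exacts [⟨0, by simp⟩, h]⟩

end Affine

section Definability

variable {F : Type u} [Field F] [LinearOrder F] {d : ℕ} {G : Model (Point F d)}
  {A : Set (Point F d)}

theorem dfn_btw (hB : Bw F d ∈ G.concepts) : G.Dfn3 A (Btw F) := dfn_of_mem_concepts hB

theorem dfn_onLine (hB : Bw F d ∈ G.concepts) : G.Dfn3 A (OnLine F) :=
  ((dfn_btw hB).comp (.proj _) (.proj _) (.proj _)).or
    (((dfn_btw hB).comp (.proj _) (.proj _) (.proj _)).or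
      ((dfn_btw hB).comp (.proj _) (.proj _) (.proj _)))

theorem dfn_pgram (hB : Bw F d ∈ G.concepts) : G.Dfn4 A (Pgram F) := by
  have hL := dfn_onLine (A := A) hB
  have hb := dfn_btw (A := A) hB
  refine (Dfn.eq (.proj _) (.proj _)).not.and ((hL.comp (.proj _) (.proj _) (.proj _)).not.and
    (.and (.not (.ex (.and (hL.comp (.proj _) (.proj _) (.proj _))
      (hL.comp (.proj _) (.proj _) (.proj _)))))
      (.and (.not (.ex (.and (hL.comp (.proj _) (.proj _) (.proj _))
      (hL.comp (.proj _) (.proj _) (.proj _)))))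
      (.ex (.and (hb.comp (.proj _) (.proj _) (.proj _))
      (hb.comp (.proj _) (.proj _) (.proj _)))))))

variable [IsStrictOrderedRing F] {α : Type*} {f g : (α → Point F d) → Point F d}

theorem exists_not_smul (hd : 2 ≤ d) (x : Point F d) : ∃ w : Point F d, ∀ s : F, w ≠ s • x := by
  obtain ⟨i, j, hij⟩ : ∃ i j : Fin d, i ≠ j := ⟨⟨0, by omega⟩, ⟨1, by omega⟩, by simp⟩
  by_contra! h
  obtain ⟨s, hs⟩ := h (Pi.single i 1)
  obtain ⟨t, ht⟩ := h (Pi.single j 1)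
  have h0 : 1 = s * x i := by simpa using congrFun hs i
  have h1 : 0 = s * x j := (Pi.single_eq_of_ne hij.symm 1).symm.trans (congrFun hs j)
  have h2 : 1 = t * x j := by simpa using congrFun ht j
  exact one_ne_zero (α := F) (by linear_combination h2 + t * x j * h0 - t * x i * h1)

theorem dfn_add (hd : 2 ≤ d) (hB : Bw F d ∈ G.concepts) :
    G.Dfn3 {0} fun x y z : Point F d => x + y = z := by
  have hP := dfn_pgram (A := {0}) hB
  exact Dfn.congr (.or (.and (.eq (.proj _) definableFun_zero) (.eq (.proj _) (.proj _)))
    (.and (.not (.eq (.proj _) definableFun_zero)) (.ex (.ex (.and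
      (hP.comp definableFun_zero (.proj _) (.proj _) (.proj _))
      (hP.comp (.proj _) (.proj _) (.proj _) (.proj _)))))))
    fun _ => add_eq_iff_pgram (exists_not_smul hd) _ _ _

theorem definableFun_add (hd : 2 ≤ d) (hB : Bw F d ∈ G.concepts)
    (hf : Set.DefinableFun G.lang {0} f) (hg : Set.DefinableFun G.lang {0} g) :
    Set.DefinableFun G.lang {0} fun x => f x + g x :=
  definableFun_of_dfn3 (dfn_add hd hB) hf hg

theorem definableFun_sub (hd : 2 ≤ d) (hB : Bw F d ∈ G.concepts)
    (hf : Set.DefinableFun G.lang {0} f) (hg : Set.DefinableFun G.lang {0} g) :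
    Set.DefinableFun G.lang {0} fun x => f x - g x :=
  definableFun_of_dfn3 (op := fun a b => a - b)
    (Dfn.congr (Dfn.eq (definableFun_add hd hB (.proj _) (.proj _)) (.proj _))
      fun _ => sub_eq_iff_eq_add.trans eq_comm) hf hg

theorem dfn_parallel (hB : Bw F d ∈ G.concepts) :
    G.Dfn2 {0} fun u w : Point F d => ∃ s : F, w = s • u :=
  Dfn.congr (.or (.eq (.proj _) definableFun_zero) (.and (.not (.eq (.proj _) definableFun_zero))
    ((dfn_onLine hB).comp definableFun_zero (.proj _) (.proj _))))
    fun _ => parallel_iff_onLine _ _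

end Definability
end CoordGeom

/-! ### Orthogonality from null vectors -/

namespace CoordGeom

open Model

universe v

section Bilinear

variable {F : Type u} [Field F] {V : Type v} [AddCommGroup V] [Module F V]

/-- The vector `x` is a sum of `k` vectors with property `P`. -/
def IterSum (P : V → Prop) : ℕ → V → Prop
  | 0, x => x = 0
  | k + 1, x => ∃ y z, P y ∧ IterSum P k z ∧ x = y + z

theorem IterSum.map {P P' : V → Prop} {f : V →ₗ[F] V} (hf : ∀ y, P y → P' (f y)) {k : ℕ} {x : V}
    (hx : IterSum P k x) : IterSum P' k (f x) := by
  induction k generalizing x with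
  | zero =>
    obtain rfl : x = 0 := hx
    exact map_zero f
  | succ k ih =>
    obtain ⟨y, z, hy, hz, rfl⟩ := hx
    exact ⟨f y, f z, hf y hy, ih hz, map_add f y z⟩

theorem IterSum.apply_eq_zero {P : V → Prop} {f : V →ₗ[F] F} (hf : ∀ y, P y → f y = 0) {k : ℕ}
    {x : V} (hx : IterSum P k x) : f x = 0 := by
  induction k generalizing x with
  | zero =>
    obtain rfl : x = 0 := hx
    exact map_zero f
  | succ k ih =>
    obtain ⟨y, z, hy, hz, rfl⟩ := hx
    rw [map_add, hf y hy, ih hz, add_zero]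

/-- The vector `u` is null, and the line `w + F u` consists of null vectors or contains none of them.
Here `N` is the set of null vectors of a bilinear form, and the condition says that `u` and `w` are
orthogonal (`nullOrth_iff`). -/
def NullOrth (N : V → Prop) (F : Type u) [Field F] [Module F V] (u w : V) : Prop :=
  N u ∧ ∀ x, (∃ s : F, x = s • u) → (N (w + x) ↔ N w)

/-- A family of vectors orthogonal to `w`: the null vectors orthogonal to `w`, and the sums of the
two points in which a line parallel to `w` meets the null cone. -/
def NullSum (N : V → Prop) (F : Type u) [Field F] [Module F V] (w x : V) : Prop :=
  NullOrth N F x w ∨ ∃ u u', N u ∧ N u' ∧ u ≠ u' ∧ (∃ s : F, u - u' = s • w) ∧ x = u + u'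

variable {B : V →ₗ[F] V →ₗ[F] F}

/-- Twice the orthogonal projection to the complement of `w`; it maps a vector to its sum with its
mirror image. -/
def twiceProj (B : V →ₗ[F] V →ₗ[F] F) (w : V) : V →ₗ[F] V :=
  (2 : F) • LinearMap.id - (2 / B w w) • (B w).smulRight w

theorem twiceProj_apply (w v : V) :
    twiceProj B w v = v + (v - (2 / B w w * B w v) • w) := by
  simp only [twiceProj, LinearMap.sub_apply, LinearMap.smul_apply, LinearMap.id_apply,
    LinearMap.smulRight_apply]
  module

variable [NeZero (2 : F)]

theorem nullOrth_iff (hB : ∀ v w, B v w = B w v) (u w : V) :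
    NullOrth (fun v => B v v = 0) F u w ↔ B u u = 0 ∧ B u w = 0 := by
  refine and_congr_right fun hu => ?_
  have key (s : F) : B (w + s • u) (w + s • u) = B w w + 2 * s * B u w := by
    simp only [map_add, map_smul, LinearMap.add_apply, LinearMap.smul_apply, smul_eq_mul, hB w u]
    linear_combination s * s * hu
  constructor
  · intro h
    by_contra huw
    by_cases hw : B w w = 0
    · have := (h _ ⟨1, rfl⟩).2 hw
      beta_reduce at this
      rw [key, hw] at this
      simp [huw, two_ne_zero (α := F)] at this
    · refine hw ((h _ ⟨-(B w w) / (2 * B u w), rfl⟩).1 ?_)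
      beta_reduce
      rw [key]
      have h2 : (2 : F) ≠ 0 := two_ne_zero
      field_simp
      ring
  · rintro h _ ⟨s, rfl⟩
    beta_reduce
    rw [key, h, mul_zero, add_zero]

/-- The two points in which a line parallel to `w` meets the null cone are mirror images of each
other in the orthogonal complement of `w`. -/
theorem NullSum.orth (hB : ∀ v w, B v w = B w v) {w x : V}
    (h : NullSum (fun v => B v v = 0) F w x) : B w x = 0 := by
  rcases h with h | ⟨u, u', hu, hu', hne, ⟨s, hs⟩, rfl⟩
  · rw [hB]
    exact ((nullOrth_iff hB _ _).1 h).2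
  · have hs0 : s ≠ 0 := by
      rintro rfl
      exact hne (by simpa [sub_eq_zero] using hs)
    have h1 : s * B w (u + u') = B (u - u') (u + u') := by
      rw [hs, map_smul, LinearMap.smul_apply, smul_eq_mul]
    have h2 : B (u - u') (u + u') = 0 := by
      simp only [map_add, map_sub, LinearMap.sub_apply, hB u' u]
      linear_combination hu - hu'
    exact (mul_eq_zero.1 (h1.trans h2)).resolve_left hs0

theorem nullSum_twiceProj (hB : ∀ v w, B v w = B w v) {w u : V} (hw : B w w ≠ 0)
    (hu : B u u = 0) : NullSum (fun v => B v v = 0) F w (twiceProj B w u) := by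
  rw [twiceProj_apply]
  by_cases h : B w u = 0
  · refine Or.inl ((nullOrth_iff hB _ _).2 ?_)
    simp [h, hu, hB u w]
  · refine Or.inr ⟨u, u - (2 / B w w * B w u) • w, hu, ?_, ?_, ⟨2 / B w w * B w u, by simp⟩, rfl⟩
    · simp only [map_sub, map_smul, LinearMap.sub_apply, LinearMap.smul_apply, smul_eq_mul,
        hB u w, hu]
      field_simp
      ring
    · intro h0
      have h1 : (2 / B w w * B w u) • w = 0 := by simpa using h0.symm
      rcases smul_eq_zero.1 h1 with h2 | rfl
      · exact mul_ne_zero (div_ne_zero two_ne_zero hw) h h2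
      · simp at hw

/-- If every vector is a sum of `k` null vectors, then orthogonality is determined by the null
vectors: twice the projection of these `k` vectors to the complement of a non-null `w` gives
summands from the family `NullSum`. -/
theorem orth_iff_iterSum (hB : ∀ v w, B v w = B w v) {k : ℕ}
    (hk : ∀ v, IterSum (fun u => B u u = 0) k v) (v w : V) :
    B v w = 0 ↔ NullOrth (fun u => B u u = 0) F w v ∨
      (B w w ≠ 0 ∧ IterSum (NullSum (fun u => B u u = 0) F w) k v) := by
  rw [nullOrth_iff hB, hB w v]
  by_cases hw : B w w = 0
  · simp [hw]
  · simp only [hw, false_and, false_or, ne_eq, not_false_eq_true, true_and]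
    constructor
    · intro h
      have h1 := IterSum.map (f := twiceProj B w) (fun y hy => nullSum_twiceProj hB hw hy)
        (hk ((2⁻¹ : F) • v))
      convert h1 using 1
      rw [twiceProj_apply, map_smul, hB w v, h, smul_zero, mul_zero, zero_smul, sub_zero,
        ← add_smul, ← two_mul, mul_inv_cancel₀ two_ne_zero, one_smul]
    · intro h
      rw [hB]
      exact h.apply_eq_zero fun y hy => hy.orth hB

end Bilinear

section Definability

variable {F : Type u} [Field F] [LinearOrder F] [IsStrictOrderedRing F] {d : ℕ}
  {G : Model (Point F d)}

theorem dfn_iterSum (hd : 2 ≤ d) (hB : Bw F d ∈ G.concepts)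
    {P : Point F d → Point F d → Prop} (hP : G.Dfn2 {0} P) (k : ℕ) :
    G.Dfn2 {0} fun w => IterSum (P w) k := by
  induction k with
  | zero => exact .eq (.proj _) definableFun_zero
  | succ k ih => exact .ex (.ex (.and (hP.comp (.proj _) (.proj _))
      (.and (ih.comp (.proj _) (.proj _))
      (.eq (.proj _) (definableFun_add hd hB (.proj _) (.proj _))))))

theorem dfn_nullOrth (hd : 2 ≤ d) (hB : Bw F d ∈ G.concepts) {N : Point F d → Prop}
    (hN : G.Dfn1 {0} N) : G.Dfn2 {0} (NullOrth N F) :=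
  .and (hN.comp (.proj _)) (.all (.imp ((dfn_parallel hB).comp (.proj _) (.proj _))
    (.iff (hN.comp (definableFun_add hd hB (.proj _) (.proj _))) (hN.comp (.proj _)))))

theorem dfn_nullSum (hd : 2 ≤ d) (hB : Bw F d ∈ G.concepts) {N : Point F d → Prop}
    (hN : G.Dfn1 {0} N) : G.Dfn2 {0} (NullSum N F) :=
  .or ((dfn_nullOrth hd hB hN).comp (.proj _) (.proj _)) (.ex (.ex
    (.and (hN.comp (.proj _)) (.and (hN.comp (.proj _)) (.and (.not (.eq (.proj _) (.proj _)))
    (.and ((dfn_parallel hB).comp (.proj _) (definableFun_sub hd hB (.proj _) (.proj _)))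
    (.eq (.proj _) (definableFun_add hd hB (.proj _) (.proj _)))))))))

end Definability

end CoordGeom

/-! ### The Euclidean and the Minkowski form -/

namespace CoordGeom

open Model

section Forms

variable {F : Type u} [Field F] {d : ℕ}

/-- The scalar product of the space components. -/
def spaceProd (v w : Point F d) : F := ∑ j : Fin d with j.val ≠ 0, v j * w j

theorem spaceProd_comm (v w : Point F d) : spaceProd v w = spaceProd w v :=
  Finset.sum_congr rfl fun _ _ => mul_comm _ _

theorem spaceProd_add_left (v v' w : Point F d) :
    spaceProd (v + v') w = spaceProd v w + spaceProd v' w := by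
  simp [spaceProd, add_mul, Finset.sum_add_distrib]

theorem spaceProd_smul_left (c : F) (v w : Point F d) :
    spaceProd (c • v) w = c * spaceProd v w := by
  simp [spaceProd, Finset.mul_sum, mul_assoc]

theorem spaceProd_add_right (v w w' : Point F d) :
    spaceProd v (w + w') = spaceProd v w + spaceProd v w' := by
  rw [spaceProd_comm, spaceProd_add_left, spaceProd_comm w, spaceProd_comm w']

theorem spaceProd_smul_right (c : F) (v w : Point F d) :
    spaceProd v (c • w) = c * spaceProd v w := by
  rw [spaceProd_comm, spaceProd_smul_left, spaceProd_comm]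

variable [NeZero d]

theorem sum_eq_zero_add (f : Fin d → F) : ∑ i, f i = f 0 + ∑ j : Fin d with j.val ≠ 0, f j := by
  rw [← Finset.add_sum_erase _ f (Finset.mem_univ 0)]
  congr 2
  ext j
  simp [Fin.val_eq_zero_iff]

theorem euclProd_eq (v w : Point F d) : euclProd v w = v 0 * w 0 + spaceProd v w :=
  sum_eq_zero_add _

theorem minkProd_eq (v w : Point F d) : minkProd v w = v 0 * w 0 - spaceProd v w := by
  rw [minkProd, sum_eq_zero_add, spaceProd, sub_eq_add_neg, ← Finset.sum_neg_distrib]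
  congr 1
  exact Finset.sum_congr rfl fun j hj => if_neg (Finset.mem_filter.1 hj).2

/-- The Euclidean scalar product as a bilinear form. -/
def euclForm : Point F d →ₗ[F] Point F d →ₗ[F] F :=
  LinearMap.mk₂ F euclProd
    (fun v v' w => by simp only [euclProd_eq, spaceProd_add_left, Pi.add_apply]; ring)
    (fun c v w => by
      simp only [euclProd_eq, spaceProd_smul_left, Pi.smul_apply, smul_eq_mul]; ring)
    (fun v w w' => by simp only [euclProd_eq, spaceProd_add_right, Pi.add_apply]; ring)
    (fun c v w => by
      simp only [euclProd_eq, spaceProd_smul_right, Pi.smul_apply, smul_eq_mul]; ring)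

/-- The Minkowski product as a bilinear form. -/
def minkForm : Point F d →ₗ[F] Point F d →ₗ[F] F :=
  LinearMap.mk₂ F minkProd
    (fun v v' w => by simp only [minkProd_eq, spaceProd_add_left, Pi.add_apply]; ring)
    (fun c v w => by
      simp only [minkProd_eq, spaceProd_smul_left, Pi.smul_apply, smul_eq_mul]; ring)
    (fun v w w' => by simp only [minkProd_eq, spaceProd_add_right, Pi.add_apply]; ring)
    (fun c v w => by
      simp only [minkProd_eq, spaceProd_smul_right, Pi.smul_apply, smul_eq_mul]; ring)

theorem euclForm_apply (v w : Point F d) : euclForm v w = v 0 * w 0 + spaceProd v w :=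
  euclProd_eq v w

theorem minkForm_apply (v w : Point F d) : minkForm v w = v 0 * w 0 - spaceProd v w :=
  minkProd_eq v w

/-- Both forms are `v 0 * w 0 + ε * spaceProd v w` with some `ε ≠ 0`. -/
theorem euclForm_apply' (v w : Point F d) : euclForm v w = v 0 * w 0 + 1 * spaceProd v w := by
  rw [euclForm_apply, one_mul]

theorem minkForm_apply' (v w : Point F d) : minkForm v w = v 0 * w 0 + -1 * spaceProd v w := by
  rw [minkForm_apply]
  ring

theorem euclForm_comm (v w : Point F d) : euclForm v w = euclForm w v := by
  rw [euclForm_apply, euclForm_apply, spaceProd_comm, mul_comm]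

theorem minkForm_comm (v w : Point F d) : minkForm v w = minkForm w v := by
  rw [minkForm_apply, minkForm_apply, spaceProd_comm, mul_comm]

/-- The vector is isotropic for the Minkowski form. -/
def Null (v : Point F d) : Prop := minkForm v v = 0

/-- The time component of the vector vanishes. -/
def Spatial (v : Point F d) : Prop := v 0 = 0

/-- The space components of the vector vanish. -/
def Axial (v : Point F d) : Prop := ∀ i : Fin d, i ≠ 0 → v i = 0

theorem spaceProd_single (v : Point F d) {i : Fin d} (hi : i ≠ 0) (c : F) :
    spaceProd v (Pi.single i c) = v i * c := by
  rw [spaceProd, Finset.sum_eq_single i]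
  · simp
  · intro j _ hj
    simp [hj]
  · simp [hi]

theorem Axial.spaceProd {v : Point F d} (hv : Axial v) (w : Point F d) :
    CoordGeom.spaceProd v w = 0 :=
  Finset.sum_eq_zero fun j hj => by
    rw [hv j fun h => (Finset.mem_filter.1 hj).2 (Fin.val_eq_zero_iff.2 h), zero_mul]

/-- The orthogonal complement of the space of spatial vectors is the time axis. -/
theorem axial_iff {B : Point F d → Point F d → F} {ε : F} (hε : ε ≠ 0)
    (hB : ∀ v w, B v w = v 0 * w 0 + ε * spaceProd v w) (v : Point F d) :
    Axial v ↔ ∀ w, Spatial w → B v w = 0 := by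
  constructor
  · intro hv w hw
    rw [hB, hv.spaceProd, show w 0 = 0 from hw, mul_zero, mul_zero, add_zero]
  · intro h i hi
    have h1 := h (Pi.single i 1) (Pi.single_eq_of_ne hi.symm 1)
    rw [hB, spaceProd_single v hi, Pi.single_eq_of_ne hi.symm] at h1
    simpa [hε] using h1

theorem spatial_iff {B : Point F d → Point F d → F} {ε : F}
    (hB : ∀ v w, B v w = v 0 * w 0 + ε * spaceProd v w) (v : Point F d) :
    Spatial v ↔ ∀ w, Axial w → B v w = 0 := by
  constructor
  · intro hv w hw
    rw [hB, spaceProd_comm, hw.spaceProd, show v 0 = 0 from hv, mul_zero, zero_mul, add_zero]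
  · intro h
    have ha : Axial (Pi.single 0 1 : Point F d) := fun i hi => Pi.single_eq_of_ne hi 1
    have h1 := h _ ha
    rw [hB, spaceProd_comm, ha.spaceProd] at h1
    show v 0 = 0
    simpa using h1

/-- Every vector is the sum of an axial and a spatial one. -/
theorem exists_axial_add_spatial (v : Point F d) :
    ∃ a b : Point F d, Axial a ∧ Spatial b ∧ v = a + b := by
  refine ⟨Pi.single 0 (v 0), v - Pi.single 0 (v 0), fun i hi => Pi.single_eq_of_ne hi _, ?_,
    (add_sub_cancel _ _).symm⟩
  simp [Spatial]

/-- The Euclidean product is the Minkowski product with the mirror image at the time axis. -/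
theorem euclForm_eq_zero_iff (v w : Point F d) :
    euclForm v w = 0 ↔
      ∃ a b, Axial a ∧ Spatial b ∧ w = a + b ∧ minkForm v (a - b) = 0 := by
  have key (a b : Point F d) (ha : Axial a) (hb : Spatial b) :
      euclForm v (a + b) = minkForm v (a - b) := by
    have hb' : b 0 = 0 := hb
    simp only [map_add, map_sub, euclForm_apply, minkForm_apply, spaceProd_comm v a, ha.spaceProd,
      hb']
    ring
  constructor
  · obtain ⟨a, b, ha, hb, rfl⟩ := exists_axial_add_spatial w
    exact fun h => ⟨a, b, ha, hb, rfl, by rwa [← key a b ha hb]⟩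
  · rintro ⟨a, b, ha, hb, rfl, h⟩
    rwa [key a b ha hb]

/-- A vector is null if its temporal and its spatial part have the same Euclidean length. -/
theorem null_iff (v : Point F d) :
    Null v ↔ ∃ a b, Axial a ∧ Spatial b ∧ v = a + b ∧ euclForm a a = euclForm b b := by
  have key (a b : Point F d) (ha : Axial a) (hb : Spatial b) :
      Null (a + b) ↔ euclForm a a = euclForm b b := by
    have hb' : b 0 = 0 := hb
    rw [Null, ← sub_eq_zero (a := euclForm a a)]
    simp only [map_add, LinearMap.add_apply, minkForm_apply, euclForm_apply, spaceProd_comm b a,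
      ha.spaceProd, hb']
    ring_nf
  constructor
  · obtain ⟨a, b, ha, hb, rfl⟩ := exists_axial_add_spatial v
    exact fun h => ⟨a, b, ha, hb, rfl, (key a b ha hb).1 h⟩
  · rintro ⟨a, b, ha, hb, rfl, h⟩
    exact (key a b ha hb).2 h

/-- `v` is an eigenvector of the Minkowski form with respect to the Euclidean one, or zero: the two
orthogonal complements of `v` agree. -/
def Eigen (v : Point F d) : Prop := ∀ w, euclForm v w = 0 ↔ minkForm v w = 0

variable [NeZero (2 : F)]

theorem eigen_iff (v : Point F d) : Eigen v ↔ Axial v ∨ Spatial v := by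
  constructor
  · intro h
    by_contra! hcon
    obtain ⟨ha, hs⟩ := hcon
    simp only [Axial, not_forall] at ha
    obtain ⟨i, hi, hvi⟩ := ha
    -- a vector in the plane of `v` and the time axis that is Euclidean orthogonal to `v`
    have h1 := (h (v i • Pi.single 0 1 - v 0 • Pi.single i 1)).1 (by
      simp only [map_sub, map_smul, euclForm_apply, spaceProd_single v hi,
        spaceProd_comm v (Pi.single 0 1), (show Axial (Pi.single 0 1 : Point F d) from
          fun i hi => Pi.single_eq_of_ne hi 1).spaceProd]
      simp [hi.symm, mul_comm])
    simp only [map_sub, map_smul, minkForm_apply, spaceProd_single v hi,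
      spaceProd_comm v (Pi.single 0 1), (show Axial (Pi.single 0 1 : Point F d) from
        fun i hi => Pi.single_eq_of_ne hi 1).spaceProd] at h1
    have h2 : 2 * (v 0 * v i) = 0 := by
      simp [hi.symm] at h1
      linear_combination h1
    exact mul_ne_zero two_ne_zero (mul_ne_zero hs hvi) h2
  · rintro (h | h) w
    · rw [euclForm_apply, minkForm_apply, h.spaceProd, add_zero, sub_zero]
    · rw [euclForm_apply, minkForm_apply, show v 0 = 0 from h]
      simp

/-- In dimension at least three the spatial vectors are distinguished among the eigenvectors by
their eigenspace being at least two-dimensional. -/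
theorem spatial_iff_eigen (hd : 3 ≤ d) (v : Point F d) :
    Spatial v ↔ v = 0 ∨ (Eigen v ∧ ∃ w, Eigen w ∧ (¬ ∃ s : F, w = s • v) ∧ Eigen (v + w)) := by
  simp only [eigen_iff]
  constructor
  · intro hv
    rcases eq_or_ne v 0 with h0 | h0
    · exact Or.inl h0
    refine Or.inr ⟨Or.inr hv, ?_⟩
    obtain ⟨i, hi⟩ := Function.ne_iff.1 h0
    have hi0 : i ≠ 0 := by
      rintro rfl
      exact hi hv
    -- a basis vector that differs from the one in the direction of time and from the `i`-th
    obtain ⟨j, hj0, hji⟩ : ∃ j : Fin d, j ≠ 0 ∧ j ≠ i := by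
      have h3 : 2 < Fintype.card (Fin d) := by rw [Fintype.card_fin]; omega
      obtain ⟨j, hj⟩ := Finset.exists_mem_notMem_of_card_lt_card
        (s := {0, i}) (t := (Finset.univ : Finset (Fin d)))
        (lt_of_le_of_lt Finset.card_le_two h3)
      exact ⟨j, by aesop⟩
    have hs : Spatial (Pi.single j 1 : Point F d) := Pi.single_eq_of_ne hj0.symm 1
    refine ⟨Pi.single j 1, Or.inr hs, ?_, Or.inr ?_⟩
    · rintro ⟨s, h⟩
      have h1 := congrFun h i
      have h2 := congrFun h j
      rw [Pi.single_eq_of_ne hji.symm] at h1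
      simp only [Pi.single_eq_same, Pi.smul_apply, smul_eq_mul] at h1 h2
      rcases mul_eq_zero.1 h1.symm with rfl | h1
      · simp at h2
      · exact hi h1
    · have h1 : v 0 = 0 := hv
      have h2 : (Pi.single j 1 : Point F d) 0 = 0 := hs
      rw [Spatial, Pi.add_apply, h1, h2, add_zero]
  · rintro (rfl | ⟨ha | hs, w, hw, hvw, hadd⟩)
    · rfl
    · by_contra hv
      have hv0 : v 0 ≠ 0 := hv
      have hwa : ¬ Axial w := by
        intro hwa
        refine hvw ⟨w 0 / v 0, funext fun i => ?_⟩
        rcases eq_or_ne i 0 with rfl | hi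
        · simp [hv0]
        · simp [ha i hi, hwa i hi]
      have hws : w 0 = 0 := hw.resolve_left hwa
      rcases hadd with hadd | hadd
      · refine hwa fun i hi => ?_
        simpa [ha i hi] using hadd i hi
      · refine hv0 ?_
        simpa [Spatial, hws] using hadd
    · exact hs

/-- Every vector is a sum of `2 d` null vectors. -/
theorem iterSum_null (hd : 2 ≤ d) (v : Point F d) : IterSum Null (2 * d) v := by
  have hsingle (i : Fin d) (c : F) :
      ∃ a b : Point F d, Null a ∧ Null b ∧ Pi.single i c = a + b := by
    -- the null vectors are half the sum and half the difference of `Pi.single i c` and a vector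
    -- of the same length, with one of the two on the time axis and the other one spatial
    have key (j : Fin d) (hj : j ≠ 0) (x y : F) (hxy : x ^ 2 = y ^ 2) :
        Null (Pi.single 0 x + Pi.single j y : Point F d) := by
      have ha : Axial (Pi.single 0 x : Point F d) := fun i hi => by simp [hi]
      simp only [Null, map_add, LinearMap.add_apply, minkForm_apply, ha.spaceProd,
        spaceProd_single _ hj, spaceProd_comm _ (Pi.single 0 x)]
      simp [hj.symm]
      linear_combination hxy
    have h2 : (2 : F) ≠ 0 := two_ne_zero
    rcases eq_or_ne i 0 with rfl | hi
    · have h1 : (⟨1, by omega⟩ : Fin d) ≠ 0 := by simp [Fin.ext_iff]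
      refine ⟨_, _, key _ h1 (c / 2) (c / 2) rfl, key _ h1 (c / 2) (-(c / 2)) (by ring), ?_⟩
      rw [Pi.single_neg, add_add_add_comm, add_neg_cancel, add_zero, ← Pi.single_add, add_halves]
    · refine ⟨_, _, key _ hi (c / 2) (c / 2) rfl, key _ hi (-(c / 2)) (c / 2) (by ring), ?_⟩
      rw [Pi.single_neg, add_add_add_comm, add_neg_cancel, zero_add, ← Pi.single_add, add_halves]
  have hsum (s : Finset (Fin d)) : IterSum Null (2 * s.card) (∑ i ∈ s, Pi.single i (v i)) := by
    induction s using Finset.induction_on with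
    | empty => exact rfl
    | insert i s hi ih =>
      obtain ⟨a, b, ha, hb, hab⟩ := hsingle i (v i)
      rw [Finset.card_insert_of_notMem hi, Finset.sum_insert hi, hab]
      exact ⟨a, _, ha, ⟨b, _, hb, ih, rfl⟩, add_assoc _ _ _⟩
  simpa [Finset.univ_sum_single] using hsum Finset.univ

end Forms
end CoordGeom

/-! ### Interdefinability of the key relations -/

namespace CoordGeom

open Model

section Concepts

variable {F : Type u} [Field F] {d : ℕ} {G : Model (Point F d)}

section Forms

variable [NeZero d]

theorem sqDistE_eq (p q : Point F d) : sqDistE p q = euclForm (p - q) (p - q) := rfl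

theorem simult_iff (p q : Point F d) : Simult p q ↔ Spatial (p - q) := by
  simp only [Simult, Spatial, Pi.sub_apply, sub_eq_zero, Fin.val_eq_zero_iff, forall_eq]

theorem atRest_iff (p q : Point F d) : AtRest p q ↔ Axial (p - q) := by
  simp only [AtRest, Axial, Pi.sub_apply, sub_eq_zero, ne_eq, Fin.val_eq_zero_iff]

theorem lightlike_iff (p q : Point F d) : Lightlike p q ↔ Null (p - q) := by
  simp only [Lightlike, Null, Fin.val_eq_zero_iff, forall_eq, minkForm_apply, sub_eq_zero,
    spaceProd, Pi.sub_apply, pow_two]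

theorem dfn_axial {B : Point F d → Point F d → F} {ε : F} (hε : ε ≠ 0)
    (hB : ∀ v w, B v w = v 0 * w 0 + ε * spaceProd v w) (h : G.Dfn2 {0} fun v w => B v w = 0)
    (hS : G.Dfn1 {0} Spatial) : G.Dfn1 {0} Axial :=
  Dfn.congr (.all (.imp (hS.comp (.proj _)) (h.comp (.proj _) (.proj _)))) fun _ => axial_iff hε hB _

theorem dfn_spatial {B : Point F d → Point F d → F} {ε : F}
    (hB : ∀ v w, B v w = v 0 * w 0 + ε * spaceProd v w) (h : G.Dfn2 {0} fun v w => B v w = 0)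
    (hR : G.Dfn1 {0} Axial) : G.Dfn1 {0} Spatial :=
  Dfn.congr (.all (.imp (hR.comp (.proj _)) (h.comp (.proj _) (.proj _)))) fun _ => spatial_iff hB _

end Forms

theorem S_mem_of_congS_mem (h : congS F d ∈ G.concepts) : S F d ∈ G.concepts := by
  have h4 : G.Dfn4 ∅ fun p q r s => sqDistE p q = sqDistE r s ∧ Simult p q ∧ Simult r s :=
    dfn_of_mem_concepts h
  exact Dfn.congr (h4.comp (definableFun_var 0) (definableFun_var 1)
    (definableFun_var 0) (definableFun_var 1))
    (Q := fun x : Fin 2 → Point F d => Simult (x 0) (x 1)) fun x => by simp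

theorem S_mem_of_delta_mem (h : delta F d ∈ G.concepts) : S F d ∈ G.concepts := by
  have h3 : G.Dfn3 ∅ fun p q r : Point F d => Simult p q ∧ Lightlike p r := dfn_of_mem_concepts h
  refine Dfn.congr (h3.comp (definableFun_var 0) (definableFun_var 1) (definableFun_var 0))
    (Q := fun x : Fin 2 → Point F d => Simult (x 0) (x 1)) fun x => ?_
  simp [Lightlike]

theorem congS_mem_of_S_mem_of_cong_mem (hS : S F d ∈ G.concepts) (h : cong F d ∈ G.concepts) :
    congS F d ∈ G.concepts := by
  have hS' : G.Dfn2 ∅ (Simult (F := F) (d := d)) := dfn_of_mem_concepts hS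
  have h' : G.Dfn ∅ fun x : Fin 4 → Point F d => sqDistE (x 0) (x 1) = sqDistE (x 2) (x 3) :=
    dfn_of_mem_concepts h
  exact h'.and (.and (hS'.comp (definableFun_var 0) (definableFun_var 1))
    (hS'.comp (definableFun_var 2) (definableFun_var 3)))

theorem delta_mem_of_S_mem_of_lam_mem (hS : S F d ∈ G.concepts) (hl : lam F d ∈ G.concepts) :
    delta F d ∈ G.concepts := by
  have hS' : G.Dfn2 ∅ (Simult (F := F) (d := d)) := dfn_of_mem_concepts hS
  have hl' : G.Dfn2 ∅ (Lightlike (F := F) (d := d)) := dfn_of_mem_concepts hl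
  have h3 : G.Dfn3 ∅ fun p q r : Point F d => Simult p q ∧ Lightlike p r :=
    .and (hS'.comp (definableFun_var 0) (definableFun_var 1))
      (hl'.comp (definableFun_var 0) (definableFun_var 2))
  exact h3

theorem lam_mem_of_delta_mem (h : delta F d ∈ G.concepts) : lam F d ∈ G.concepts := by
  have h3 : G.Dfn3 ∅ fun p q r : Point F d => Simult p q ∧ Lightlike p r := dfn_of_mem_concepts h
  refine Dfn.congr (h3.comp (definableFun_var 0) (definableFun_var 0) (definableFun_var 1))
    (Q := fun x : Fin 2 → Point F d => Lightlike (x 0) (x 1)) fun x => ?_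
  simp [Simult]

variable [LinearOrder F]

theorem transInv_of_subset (hG : G ⊆ insert (Bw F d) (keyRelations F d)) : G.TransInv := by
  intro a R hR x
  have hs (p q : Point F d) : Simult (p + a) (q + a) ↔ Simult p q := by simp [Simult]
  have hl (p q : Point F d) : Lightlike (p + a) (q + a) ↔ Lightlike p q := by simp [Lightlike]
  rcases hG hR with rfl | rfl | rfl | rfl | rfl | rfl | rfl | rfl
  · change Fin 3 → Point F d at x
    have h (l : F) : x 1 + a = x 0 + a + l • (x 2 + a - (x 0 + a)) ↔
        x 1 = x 0 + l • (x 2 - x 0) := by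
      rw [add_right_comm, add_left_inj, add_sub_add_right_eq_sub]
    exact exists_congr fun l => and_congr_right fun _ => and_congr_right fun _ => h l
  · change Fin 4 → Point F d at x
    exact (by simp [sqDistE] : sqDistE (x 0 + a) (x 1 + a) = sqDistE (x 2 + a) (x 3 + a) ↔
      sqDistE (x 0) (x 1) = sqDistE (x 2) (x 3))
  · change Fin 4 → Point F d at x
    exact (by simp [sqDistM] : sqDistM (x 0 + a) (x 1 + a) = sqDistM (x 2 + a) (x 3 + a) ↔
      sqDistM (x 0) (x 1) = sqDistM (x 2) (x 3))
  · exact hl _ _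
  · change Fin 4 → Point F d at x
    exact (by simp [sqDistE, Simult] : (sqDistE (x 0 + a) (x 1 + a) = sqDistE (x 2 + a) (x 3 + a) ∧
      Simult (x 0 + a) (x 1 + a) ∧ Simult (x 2 + a) (x 3 + a)) ↔
      (sqDistE (x 0) (x 1) = sqDistE (x 2) (x 3) ∧ Simult (x 0) (x 1) ∧ Simult (x 2) (x 3)))
  · exact hs _ _
  · change Fin 2 → Point F d at x
    exact (by simp [AtRest] : AtRest (x 0 + a) (x 1 + a) ↔ AtRest (x 0) (x 1))
  · exact and_congr (hs _ _) (hl _ _)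

theorem Bw_mem_LClass : Bw F d ∈ LClass F d := Or.inr (Or.inr rfl)

theorem LClass_subset : LClass F d ⊆ insert (Bw F d) (keyRelations F d) := by
  rintro R (rfl | rfl | rfl) <;> simp [keyRelations]

variable [IsStrictOrderedRing F]

/-- A relation that holds between two points depending on their difference is a concept exactly if
the corresponding set of vectors is definable. -/
theorem mem_concepts_iff_dfn1 (hd : 2 ≤ d)
    (hG : G.TransInv) (hB : Bw F d ∈ G.concepts) {N : Point F d → Prop}
    {R : Set (Fin 2 → Point F d)} (hR : ∀ x, x ∈ R ↔ N (x 0 - x 1)) :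
    (⟨2, R⟩ : FinRel (Point F d)) ∈ G.concepts ↔ G.Dfn1 {0} N := by
  constructor
  · intro h
    have h2 : G.Dfn2 {0} fun p q => N (p - q) :=
      Dfn.congr (dfn_of_mem_concepts h) fun x => (hR x).symm
    exact Dfn.congr (h2.comp (.proj _) definableFun_zero) fun x => by rw [sub_zero]
  · intro h
    refine hG.mem_concepts (Dfn.congr (h.comp (definableFun_sub hd hB (definableFun_var 0)
      (definableFun_var 1))) hR) fun a x => ?_
    rw [hR, hR, add_sub_add_right_eq_sub]

/-- Congruence is a concept exactly if orthogonality of vectors is definable: the vectors `v`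
and `w` have the same length exactly if `v + w` and `v - w` are orthogonal. -/
theorem mem_concepts_iff_dfn2 (hd : 2 ≤ d)
    (hG : G.TransInv) (hB : Bw F d ∈ G.concepts) {B : Point F d →ₗ[F] Point F d →ₗ[F] F}
    (hsymm : ∀ v w, B v w = B w v) {R : Set (Fin 4 → Point F d)}
    (hR : ∀ x, x ∈ R ↔ B (x 0 - x 1) (x 0 - x 1) = B (x 2 - x 3) (x 2 - x 3)) :
    (⟨4, R⟩ : FinRel (Point F d)) ∈ G.concepts ↔ G.Dfn2 {0} fun v w => B v w = 0 := by
  constructor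
  · intro h
    have h4 : G.Dfn4 {0} fun p q r s => B (p - q) (p - q) = B (r - s) (r - s) :=
      Dfn.congr (dfn_of_mem_concepts h) fun x => (hR x).symm
    refine Dfn.congr (h4.comp (definableFun_add hd hB (definableFun_var 0) (definableFun_var 1))
      definableFun_zero (definableFun_sub hd hB (definableFun_var 0) (definableFun_var 1))
      definableFun_zero) fun x => ?_
    have key : B (x 0 + x 1 - 0) (x 0 + x 1 - 0) - B (x 0 - x 1 - 0) (x 0 - x 1 - 0)
        = 4 * B (x 0) (x 1) := by
      simp only [sub_zero, map_add, map_sub, LinearMap.add_apply, LinearMap.sub_apply,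
        hsymm (x 1) (x 0)]
      ring
    rw [← sub_eq_zero (b := B (x 0 - x 1 - 0) _), key]
    simp
  · intro h
    have hsub (i j : Fin 4) := definableFun_sub (G := G) hd hB (definableFun_var i)
      (definableFun_var j)
    refine hG.mem_concepts (Dfn.congr (h.comp (definableFun_add hd hB (hsub 0 1) (hsub 2 3))
      (definableFun_sub hd hB (hsub 0 1) (hsub 2 3))) fun x => ?_) fun a x => ?_
    · rw [hR, ← sub_eq_zero]
      generalize x 0 - x 1 = v
      generalize x 2 - x 3 = w
      simp only [map_add, map_sub, LinearMap.add_apply, hsymm w v]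
      refine iff_of_eq (congrArg (· = 0) ?_)
      ring
    · rw [hR, hR]
      simp only [add_sub_add_right_eq_sub]

variable [NeZero d]

theorem S_mem_iff (hd : 2 ≤ d) (hG : G.TransInv) (hB : Bw F d ∈ G.concepts) :
    S F d ∈ G.concepts ↔ G.Dfn1 {0} Spatial :=
  mem_concepts_iff_dfn1 hd hG hB fun _ => simult_iff _ _

theorem Rest_mem_iff (hd : 2 ≤ d) (hG : G.TransInv) (hB : Bw F d ∈ G.concepts) :
    Rest F d ∈ G.concepts ↔ G.Dfn1 {0} Axial :=
  mem_concepts_iff_dfn1 hd hG hB fun _ => atRest_iff _ _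

theorem lam_mem_iff (hd : 2 ≤ d) (hG : G.TransInv) (hB : Bw F d ∈ G.concepts) :
    lam F d ∈ G.concepts ↔ G.Dfn1 {0} Null :=
  mem_concepts_iff_dfn1 hd hG hB fun _ => lightlike_iff _ _

theorem cong_mem_iff (hd : 2 ≤ d) (hG : G.TransInv) (hB : Bw F d ∈ G.concepts) :
    cong F d ∈ G.concepts ↔ G.Dfn2 {0} fun v w => euclForm v w = 0 :=
  mem_concepts_iff_dfn2 hd hG hB euclForm_comm fun _ => Iff.rfl

theorem congMu_mem_iff (hd : 2 ≤ d) (hG : G.TransInv) (hB : Bw F d ∈ G.concepts) :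
    congMu F d ∈ G.concepts ↔ G.Dfn2 {0} fun v w => minkForm v w = 0 :=
  mem_concepts_iff_dfn2 hd hG hB minkForm_comm fun _ => Iff.rfl

/-- Minkowski congruence and lightlike relatedness are interdefinable over an arbitrary ordered
field. -/
theorem congMu_mem_iff_lam_mem (hd : 2 ≤ d) (hG : G.TransInv) (hB : Bw F d ∈ G.concepts) :
    congMu F d ∈ G.concepts ↔ lam F d ∈ G.concepts := by
  rw [congMu_mem_iff hd hG hB, lam_mem_iff hd hG hB]
  constructor
  · exact fun h => h.comp (definableFun_var 0) (definableFun_var 0)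
  · intro h
    refine Dfn.congr (.or
      ((dfn_nullOrth hd hB h).comp (definableFun_var 1) (definableFun_var 0))
      (.and (.not (h.comp (definableFun_var 1)))
        ((dfn_iterSum hd hB (dfn_nullSum hd hB h) (2 * d)).comp
          (definableFun_var 1) (definableFun_var 0))))
      fun _ => orth_iff_iterSum minkForm_comm (iterSum_null hd) _ _

theorem S_mem_of_Rest_mem_of_cong_mem (hd : 2 ≤ d) (hG : G.TransInv) (hB : Bw F d ∈ G.concepts)
    (hR : Rest F d ∈ G.concepts) (h : cong F d ∈ G.concepts) : S F d ∈ G.concepts := by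
  rw [S_mem_iff hd hG hB]
  rw [Rest_mem_iff hd hG hB] at hR
  rw [cong_mem_iff hd hG hB] at h
  exact dfn_spatial euclForm_apply' h hR

theorem S_mem_of_Rest_mem_of_lam_mem (hd : 2 ≤ d) (hG : G.TransInv) (hB : Bw F d ∈ G.concepts)
    (hR : Rest F d ∈ G.concepts) (h : lam F d ∈ G.concepts) : S F d ∈ G.concepts := by
  rw [S_mem_iff hd hG hB]
  rw [Rest_mem_iff hd hG hB] at hR
  rw [← congMu_mem_iff_lam_mem hd hG hB, congMu_mem_iff hd hG hB] at h
  exact dfn_spatial minkForm_apply' h hR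

theorem lam_mem_of_S_mem_of_cong_mem (hd : 2 ≤ d) (hG : G.TransInv) (hB : Bw F d ∈ G.concepts)
    (hS : S F d ∈ G.concepts) (h : cong F d ∈ G.concepts) : lam F d ∈ G.concepts := by
  have h4 : G.Dfn4 {0} fun p q r s => sqDistE p q = sqDistE r s := dfn_of_mem_concepts h
  rw [S_mem_iff hd hG hB] at hS
  rw [cong_mem_iff hd hG hB] at h
  rw [lam_mem_iff hd hG hB]
  have hA := dfn_axial one_ne_zero euclForm_apply' h hS
  have key : G.Dfn1 {0} fun v => ∃ a b, Axial a ∧ Spatial b ∧ v = a + b ∧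
      sqDistE a 0 = sqDistE b 0 :=
    .ex (.ex (.and (hA.comp (.proj _)) (.and (hS.comp (.proj _)) (.and
      (.eq (.proj _) (definableFun_add hd hB (.proj _) (.proj _)))
      (h4.comp (.proj _) definableFun_zero (.proj _) definableFun_zero)))))
  exact Dfn.congr key fun v => by simp only [null_iff, sqDistE_eq, sub_zero]

/-- In dimension at least three the Euclidean and the Minkowski form together determine
simultaneity. -/
theorem S_mem_of_cong_mem_of_lam_mem (hd : 3 ≤ d) (hG : G.TransInv) (hB : Bw F d ∈ G.concepts)
    (h : cong F d ∈ G.concepts) (hl : lam F d ∈ G.concepts) : S F d ∈ G.concepts := by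
  have hd2 : 2 ≤ d := by omega
  rw [S_mem_iff hd2 hG hB]
  rw [cong_mem_iff hd2 hG hB] at h
  rw [← congMu_mem_iff_lam_mem hd2 hG hB, congMu_mem_iff hd2 hG hB] at hl
  have hE : G.Dfn1 {0} Eigen :=
    .all (.iff (h.comp (.proj _) (.proj _)) (hl.comp (.proj _) (.proj _)))
  exact Dfn.congr (.or (.eq (.proj _) definableFun_zero) (.and (hE.comp (.proj _))
    (.ex (.and (hE.comp (.proj _)) (.and (.not ((dfn_parallel hB).comp (.proj _) (.proj _)))
    (hE.comp (definableFun_add hd2 hB (.proj _) (.proj _)))))))) fun _ => spatial_iff_eigen hd _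

theorem cong_mem_of_S_mem_of_lam_mem (hd : 2 ≤ d) (hG : G.TransInv) (hB : Bw F d ∈ G.concepts)
    (hS : S F d ∈ G.concepts) (hl : lam F d ∈ G.concepts) : cong F d ∈ G.concepts := by
  rw [S_mem_iff hd hG hB] at hS
  rw [← congMu_mem_iff_lam_mem hd hG hB, congMu_mem_iff hd hG hB] at hl
  rw [cong_mem_iff hd hG hB]
  have hA := dfn_axial (neg_ne_zero.2 one_ne_zero) minkForm_apply' hl hS
  exact Dfn.congr (.ex (.ex (.and (hA.comp (.proj _)) (.and (hS.comp (.proj _)) (.and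
    (.eq (.proj _) (definableFun_add hd hB (.proj _) (.proj _)))
    (hl.comp (.proj _) (definableFun_sub hd hB (.proj _) (.proj _))))))))
    fun _ => euclForm_eq_zero_iff _ _

theorem Rest_mem_of_S_mem_of_cong_mem (hd : 2 ≤ d) (hG : G.TransInv) (hB : Bw F d ∈ G.concepts)
    (hS : S F d ∈ G.concepts) (h : cong F d ∈ G.concepts) : Rest F d ∈ G.concepts := by
  rw [S_mem_iff hd hG hB] at hS
  rw [cong_mem_iff hd hG hB] at h
  rw [Rest_mem_iff hd hG hB]
  exact dfn_axial one_ne_zero euclForm_apply' h hS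

/-- Simultaneity and lightlike relatedness define all key relations. -/
theorem keyRelations_subset_concepts (hd : 2 ≤ d) (hG : G.TransInv) (hB : Bw F d ∈ G.concepts)
    (hS : S F d ∈ G.concepts) (hl : lam F d ∈ G.concepts) : keyRelations F d ⊆ G.concepts := by
  have hc := cong_mem_of_S_mem_of_lam_mem hd hG hB hS hl
  rintro R (rfl | rfl | rfl | rfl | rfl | rfl | rfl)
  · exact hc
  · exact (congMu_mem_iff_lam_mem hd hG hB).2 hl
  · exact hl
  · exact congS_mem_of_S_mem_of_cong_mem hS hc
  · exact hS
  · exact Rest_mem_of_S_mem_of_cong_mem hd hG hB hS hc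
  · exact delta_mem_of_S_mem_of_lam_mem hS hl

/-- The criterion by which the expansions are recognized as late classical spacetime. -/
theorem defEquiv_LClass (hd : 2 ≤ d) (hG : G ⊆ insert (Bw F d) (keyRelations F d))
    (hB : Bw F d ∈ G) (hS : S F d ∈ G.concepts) (hl : lam F d ∈ G.concepts) :
    G.DefEquiv (LClass F d) := by
  have hL := transInv_of_subset (LClass_subset (F := F) (d := d))
  have hB' : Bw F d ∈ (LClass F d).concepts := mem_concepts_of_mem Bw_mem_LClass
  have hK := keyRelations_subset_concepts hd (transInv_of_subset hG) (mem_concepts_of_mem hB) hS hl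
  have hKL := keyRelations_subset_concepts hd hL hB'
    (S_mem_of_congS_mem (mem_concepts_of_mem (Or.inr (Or.inl rfl))))
    (mem_concepts_of_mem (Or.inl rfl))
  exact defEquiv_of_subset
    (hG.trans (Set.insert_subset hB' hKL))
    (LClass_subset.trans (Set.insert_subset (mem_concepts_of_mem hB) hK))

end Concepts

end CoordGeom

/-! ### Automorphisms acting on a coordinate plane -/

namespace CoordGeom

open Model

section Plane

theorem point_ext {F : Type u} {n : ℕ} {v w : Point F (n + 2)} (h0 : v 0 = w 0) (h1 : v 1 = w 1)
    (h : ∀ i : Fin n, v i.succ.succ = w i.succ.succ) : v = w :=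
  funext fun i => Fin.cases h0 (fun i => Fin.cases h1 h i) i

variable {F : Type u} [Field F] {n : ℕ}

/-- The linear map with matrix `!![a, b; c, e]` on the plane of the time axis and the first space
axis, fixing the other coordinates. -/
def planeMap (a b c e : F) : Point F (n + 2) →ₗ[F] Point F (n + 2) where
  toFun v := Fin.cons (a * v 0 + b * v 1)
    (Fin.cons (c * v 0 + e * v 1) fun i : Fin n => v i.succ.succ)
  map_add' v w := by
    funext i
    refine Fin.cases ?_ (fun i => Fin.cases ?_ (fun i => ?_) i) i
    · simp only [Fin.cons_zero, Pi.add_apply]; ring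
    · simp only [Fin.cons_zero, Fin.cons_succ, Pi.add_apply]; ring
    · simp only [Fin.cons_succ, Pi.add_apply]
  map_smul' r v := by
    funext i
    refine Fin.cases ?_ (fun i => Fin.cases ?_ (fun i => ?_) i) i
    · simp only [Fin.cons_zero, Pi.smul_apply, smul_eq_mul, RingHom.id_apply]; ring
    · simp only [Fin.cons_zero, Fin.cons_succ, Pi.smul_apply, smul_eq_mul, RingHom.id_apply]; ring
    · simp only [Fin.cons_succ, Pi.smul_apply, RingHom.id_apply]

variable {a b c e : F}

@[simp]
theorem planeMap_zero (v : Point F (n + 2)) : planeMap a b c e v 0 = a * v 0 + b * v 1 := rfl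

@[simp]
theorem planeMap_one (v : Point F (n + 2)) : planeMap a b c e v 1 = c * v 0 + e * v 1 := rfl

@[simp]
theorem planeMap_succ_succ (v : Point F (n + 2)) (i : Fin n) :
    planeMap a b c e v i.succ.succ = v i.succ.succ := rfl

/-- `planeMap` as a linear equivalence. -/
def planeEquiv (a b c e : F) (h : a * e - b * c ≠ 0) :
    Point F (n + 2) ≃ₗ[F] Point F (n + 2) :=
  have hk := inv_mul_cancel₀ h
  let k := (a * e - b * c)⁻¹
  LinearEquiv.ofLinearMap (planeMap a b c e) (planeMap (k * e) (-(k * b)) (-(k * c)) (k * a))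
    (LinearMap.ext fun v => point_ext
      (by simp only [LinearMap.comp_apply, planeMap_zero, planeMap_one, LinearMap.id_apply]
          linear_combination v 0 * hk)
      (by simp only [LinearMap.comp_apply, planeMap_zero, planeMap_one, LinearMap.id_apply]
          linear_combination v 1 * hk)
      fun i => by simp only [LinearMap.comp_apply, planeMap_succ_succ, LinearMap.id_apply])
    (LinearMap.ext fun v => point_ext
      (by simp only [LinearMap.comp_apply, planeMap_zero, planeMap_one, LinearMap.id_apply]
          linear_combination v 0 * hk)
      (by simp only [LinearMap.comp_apply, planeMap_zero, planeMap_one, LinearMap.id_apply]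
          linear_combination v 1 * hk)
      fun i => by simp only [LinearMap.comp_apply, planeMap_succ_succ, LinearMap.id_apply])

theorem planeEquiv_apply (h : a * e - b * c ≠ 0) (v : Point F (n + 2)) :
    planeEquiv a b c e h v = planeMap a b c e v := rfl

theorem spaceProd_eq_add_sum (v w : Point F (n + 2)) :
    spaceProd v w = v 1 * w 1 + ∑ i : Fin n, v i.succ.succ * w i.succ.succ := by
  have h := sum_eq_zero_add fun i => v i * w i
  rw [Fin.sum_univ_succ, Fin.sum_univ_succ] at h
  exact (add_left_cancel h).symm

/-- The quadratic forms change under `planeMap` only by their values on the plane. -/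
theorem spaceProd_planeMap (v : Point F (n + 2)) :
    spaceProd (planeMap a b c e v) (planeMap a b c e v) =
      spaceProd v v + (c * v 0 + e * v 1) ^ 2 - v 1 ^ 2 := by
  simp only [spaceProd_eq_add_sum, planeMap_one, planeMap_succ_succ]
  ring

/-- The vector of the plane of the time axis and the first space axis with the given
coordinates. -/
def planeVec (x y : F) : Point F (n + 2) := Fin.cons x (Fin.cons y 0)

@[simp]
theorem planeVec_zero (x y : F) : (planeVec x y : Point F (n + 2)) 0 = x := rfl

@[simp]
theorem planeVec_one (x y : F) : (planeVec x y : Point F (n + 2)) 1 = y := rfl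

@[simp]
theorem spaceProd_planeVec (x y : F) :
    spaceProd (planeVec x y : Point F (n + 2)) (planeVec x y) = y ^ 2 := by
  simp [spaceProd_eq_add_sum, planeVec, pow_two]

theorem axial_planeVec (x : F) : Axial (planeVec x 0 : Point F (n + 2)) := by
  intro i
  refine Fin.cases (fun h => absurd rfl h) (fun i _ => ?_) i
  refine Fin.cases ?_ (fun i => ?_) i <;> simp [planeVec]

end Plane

section Invariance

variable {F : Type u} [Field F] {d : ℕ} {f : Point F d ≃ₗ[F] Point F d}

/-- Invariance of a relation under a linear equivalence. -/
def IsInvariant (f : Point F d ≃ₗ[F] Point F d) (R : FinRel (Point F d)) : Prop :=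
  ∀ x : Fin R.1 → Point F d, f.toEquiv ∘ x ∈ R.2 ↔ x ∈ R.2

theorem inv_iff {N : Point F d → Prop} {R : Set (Fin 2 → Point F d)}
    (hR : ∀ x, x ∈ R ↔ N (x 0 - x 1)) : IsInvariant f ⟨2, R⟩ ↔ ∀ v, N (f v) ↔ N v := by
  constructor
  · intro h v
    have h1 := h ![v, 0]
    rw [hR, hR] at h1
    simpa using h1
  · intro h x
    have h1 := h (x 0 - x 1)
    rw [map_sub] at h1
    rwa [hR, hR]

theorem inv_Bw [LinearOrder F] : IsInvariant f (Bw F d) := by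
  intro x
  change Fin 3 → Point F d at x
  refine exists_congr fun l => and_congr_right fun _ => and_congr_right fun _ => ?_
  change f (x 1) = f (x 0) + l • (f (x 2) - f (x 0)) ↔ _
  rw [← map_sub, ← map_smul, ← map_add, f.injective.eq_iff]

variable [NeZero d]

theorem inv_S_iff : IsInvariant f (S F d) ↔ ∀ v, Spatial (f v) ↔ Spatial v :=
  inv_iff fun _ => simult_iff _ _

theorem inv_Rest_iff : IsInvariant f (Rest F d) ↔ ∀ v, Axial (f v) ↔ Axial v :=
  inv_iff fun _ => atRest_iff _ _

theorem inv_lam_iff : IsInvariant f (lam F d) ↔ ∀ v, Null (f v) ↔ Null v :=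
  inv_iff fun _ => lightlike_iff _ _

theorem inv_cong (h : ∀ v, euclForm (f v) (f v) = euclForm v v) : IsInvariant f (cong F d) := by
  intro x
  change Fin 4 → Point F d at x
  change sqDistE (f (x 0)) (f (x 1)) = sqDistE (f (x 2)) (f (x 3)) ↔
    sqDistE (x 0) (x 1) = sqDistE (x 2) (x 3)
  simp only [sqDistE_eq, ← map_sub, h]

theorem inv_congS (hS : ∀ v, Spatial (f v) ↔ Spatial v)
    (h : ∀ v, Spatial v → euclForm (f v) (f v) = euclForm v v) : IsInvariant f (congS F d) := by
  intro x
  change Fin 4 → Point F d at x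
  change (sqDistE (f (x 0)) (f (x 1)) = sqDistE (f (x 2)) (f (x 3)) ∧
      Simult (f (x 0)) (f (x 1)) ∧ Simult (f (x 2)) (f (x 3))) ↔
    (sqDistE (x 0) (x 1) = sqDistE (x 2) (x 3) ∧ Simult (x 0) (x 1) ∧ Simult (x 2) (x 3))
  simp only [sqDistE_eq, simult_iff, ← map_sub, hS]
  exact and_congr_left fun hs => by rw [h _ hs.1, h _ hs.2]

end Invariance

section NonConcepts

variable {F : Type u} [Field F] [LinearOrder F] [IsStrictOrderedRing F] {n : ℕ}

theorem Eucl_not_mem : S F (n + 2) ∉ (Eucl F (n + 2)).concepts ∧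
    Rest F (n + 2) ∉ (Eucl F (n + 2)).concepts ∧ lam F (n + 2) ∉ (Eucl F (n + 2)).concepts := by
  -- the rotation with cosine `3 / 5`
  let f : Point F (n + 2) ≃ₗ[F] Point F (n + 2) :=
    planeEquiv (3 / 5) (-(4 / 5)) (4 / 5) (3 / 5) (by norm_num)
  have hf : (Eucl F (n + 2)).Preserves f.toEquiv := by
    rintro R (rfl | rfl)
    · refine inv_cong fun v => ?_
      simp only [f, planeEquiv_apply, euclForm_apply, spaceProd_planeMap, planeMap_zero]
      ring
    · exact inv_Bw
  refine ⟨fun h => ?_, fun h => ?_, fun h => ?_⟩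
  · have h1 := (inv_S_iff.1 (hf.mem_iff h) (planeVec 0 1)).2 (planeVec_zero _ _)
    simp [Spatial, f, planeEquiv_apply] at h1
  · have h1 := (inv_Rest_iff.1 (hf.mem_iff h) (planeVec 1 0)).2 (axial_planeVec 1) 1 (by simp)
    simp [f, planeEquiv_apply] at h1
  · have h1 := (inv_lam_iff.1 (hf.mem_iff h) (planeVec 1 1)).2 (by simp [Null, minkForm_apply])
    simp [Null, minkForm_apply, f, planeEquiv_apply, spaceProd_planeMap] at h1
    norm_num at h1

theorem Rel_not_mem : S F (n + 2) ∉ (Rel F (n + 2)).concepts ∧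
    Rest F (n + 2) ∉ (Rel F (n + 2)).concepts ∧ cong F (n + 2) ∉ (Rel F (n + 2)).concepts := by
  -- the Lorentz boost with velocity `3 / 5`
  let f : Point F (n + 2) ≃ₗ[F] Point F (n + 2) :=
    planeEquiv (5 / 4) (3 / 4) (3 / 4) (5 / 4) (by norm_num)
  have hf : (Rel F (n + 2)).Preserves f.toEquiv := by
    rintro R (rfl | rfl)
    · refine inv_lam_iff.2 fun v => ?_
      simp only [Null, f, planeEquiv_apply, minkForm_apply, spaceProd_planeMap, planeMap_zero]
      refine iff_of_eq (congrArg (· = 0) ?_)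
      ring
    · exact inv_Bw
  refine ⟨fun h => ?_, fun h => ?_, fun h => ?_⟩
  · have h1 := (inv_S_iff.1 (hf.mem_iff h) (planeVec 0 1)).2 (planeVec_zero _ _)
    simp [Spatial, f, planeEquiv_apply] at h1
  · have h1 := (inv_Rest_iff.1 (hf.mem_iff h) (planeVec 1 0)).2 (axial_planeVec 1) 1 (by simp)
    simp [f, planeEquiv_apply] at h1
  · -- two lightlike vectors of the same length, of which one is stretched and one is shrunk
    have h1 := (hf.mem_iff h ![planeVec 1 1, 0, planeVec 1 (-1), 0]).2 (by
      change sqDistE (planeVec 1 1 : Point F (n + 2)) 0 = sqDistE (planeVec 1 (-1)) 0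
      simp [sqDistE_eq, euclForm_apply])
    change sqDistE (f (planeVec 1 1)) (f 0) = sqDistE (f (planeVec 1 (-1))) (f 0) at h1
    simp only [map_zero, sub_zero, sqDistE_eq, euclForm_apply, f, planeEquiv_apply,
      spaceProd_planeMap, planeMap_zero, planeVec_zero, planeVec_one, spaceProd_planeVec] at h1
    norm_num at h1

theorem Gal_not_mem : Rest F (n + 2) ∉ (Gal F (n + 2)).concepts := by
  -- a Galilean boost
  let f : Point F (n + 2) ≃ₗ[F] Point F (n + 2) := planeEquiv 1 0 1 1 (by norm_num)
  have hf : (Gal F (n + 2)).Preserves f.toEquiv := by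
    rintro R (rfl | rfl)
    · refine inv_congS (fun v => by simp [Spatial, f, planeEquiv_apply]) fun v hv => ?_
      have hv0 : v 0 = 0 := hv
      simp [f, planeEquiv_apply, euclForm_apply, spaceProd_planeMap, hv0]
    · exact inv_Bw
  intro h
  have h1 := (inv_Rest_iff.1 (hf.mem_iff h) (planeVec 1 0)).2 (axial_planeVec 1) 1 (by simp)
  simp [f, planeEquiv_apply] at h1

theorem Newt_not_mem : lam F (n + 2) ∉ (Newt F (n + 2)).concepts := by
  -- a change of the unit of time
  let f : Point F (n + 2) ≃ₗ[F] Point F (n + 2) := planeEquiv 2 0 0 1 (by norm_num)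
  have hf : (Newt F (n + 2)).Preserves f.toEquiv := by
    rintro R (rfl | rfl | rfl)
    · refine inv_Rest_iff.2 fun v => forall_congr' fun i => ?_
      refine Fin.cases (by simp) (fun i => Fin.cases ?_ (fun i => ?_) i) i
      · simp [f, planeEquiv_apply]
      · simp [f, planeEquiv_apply]
    · refine inv_congS (fun v => by simp [Spatial, f, planeEquiv_apply]) fun v hv => ?_
      have hv0 : v 0 = 0 := hv
      simp [f, planeEquiv_apply, euclForm_apply, spaceProd_planeMap, hv0]
    · exact inv_Bw
  intro h
  have h1 := (inv_lam_iff.1 (hf.mem_iff h) (planeVec 1 1)).2 (by simp [Null, minkForm_apply])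
  simp [Null, minkForm_apply, f, planeEquiv_apply, spaceProd_planeMap] at h1
  norm_num at h1

/-- In dimension two the exchange of the two coordinates preserves the Euclidean metric and the
light cones. -/
theorem Eucl_expand_lam_not_mem : S F 2 ∉ ((Eucl F 2).expand (lam F 2)).concepts := by
  let f : Point F 2 ≃ₗ[F] Point F 2 := planeEquiv (n := 0) 0 1 1 0 (by norm_num)
  have hf : ((Eucl F 2).expand (lam F 2)).Preserves f.toEquiv := by
    rintro R (rfl | rfl | rfl)
    · refine inv_lam_iff.2 fun v => ?_
      simp only [Null, f, planeEquiv_apply, minkForm_apply, spaceProd_planeMap, planeMap_zero]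
      rw [← neg_eq_zero, spaceProd_eq_add_sum (n := 0)]
      refine iff_of_eq (congrArg (· = 0) ?_)
      simp
      ring
    · refine inv_cong fun v => ?_
      simp only [f, planeEquiv_apply, euclForm_apply, spaceProd_planeMap, planeMap_zero]
      ring
    · exact inv_Bw
  intro h
  have h1 := (inv_S_iff.1 (hf.mem_iff h) (planeVec (n := 0) 0 1)).2 (planeVec_zero _ _)
  simp [Spatial, f, planeEquiv_apply] at h1

end NonConcepts

end CoordGeom

/-! ### Concepts of the four geometries and their expansions -/

namespace CoordGeom

open Model

section Classification

variable {F : Type u} [Field F] [LinearOrder F] {d : ℕ} {G : Model (Point F d)}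
  {R : FinRel (Point F d)}

theorem Eucl_subset : Eucl F d ⊆ insert (Bw F d) (keyRelations F d) := by
  rintro R (rfl | rfl) <;> simp [keyRelations]

theorem Rel_subset : Rel F d ⊆ insert (Bw F d) (keyRelations F d) := by
  rintro R (rfl | rfl) <;> simp [keyRelations]

theorem Gal_subset : Gal F d ⊆ insert (Bw F d) (keyRelations F d) := by
  rintro R (rfl | rfl) <;> simp [keyRelations]

theorem Newt_subset : Newt F d ⊆ insert (Bw F d) (keyRelations F d) := by
  rintro R (rfl | rfl | rfl) <;> simp [keyRelations]

theorem Gal_subset_Newt_concepts : Gal F d ⊆ (Newt F d).concepts :=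
  fun _ h => mem_concepts_of_mem (Or.inr h)

/-- The two models have the same basic relations. -/
theorem Rel_expand_cong_eq : (Rel F d).expand (cong F d) = (Eucl F d).expand (lam F d) :=
  Set.insert_comm _ _ _

variable [IsStrictOrderedRing F]

theorem keyRelations_inter_Eucl (hd : 2 ≤ d) :
    keyRelations F d ∩ (Eucl F d).concepts = {cong F d} := by
  obtain ⟨n, rfl⟩ := Nat.exists_eq_add_of_le' hd
  obtain ⟨hS, hRest, hl⟩ := Eucl_not_mem (F := F) (n := n)
  have hT := transInv_of_subset (Eucl_subset (F := F) (d := n + 2))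
  have hB : Bw F (n + 2) ∈ (Eucl F (n + 2)).concepts := mem_concepts_of_mem (Or.inr rfl)
  refine Set.Subset.antisymm ?_ (Set.singleton_subset_iff.2
    ⟨Or.inl rfl, mem_concepts_of_mem (Or.inl rfl)⟩)
  rintro R ⟨rfl | rfl | rfl | rfl | rfl | rfl | rfl, h⟩
  · rfl
  · exact absurd ((congMu_mem_iff_lam_mem hd hT hB).1 h) hl
  · exact absurd h hl
  · exact absurd (S_mem_of_congS_mem h) hS
  · exact absurd h hS
  · exact absurd h hRest
  · exact absurd (S_mem_of_delta_mem h) hS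

theorem keyRelations_inter_Rel (hd : 2 ≤ d) :
    keyRelations F d ∩ (Rel F d).concepts = {congMu F d, lam F d} := by
  obtain ⟨n, rfl⟩ := Nat.exists_eq_add_of_le' hd
  obtain ⟨hS, hRest, hc⟩ := Rel_not_mem (F := F) (n := n)
  have hT := transInv_of_subset (Rel_subset (F := F) (d := n + 2))
  have hB : Bw F (n + 2) ∈ (Rel F (n + 2)).concepts := mem_concepts_of_mem (Or.inr rfl)
  have hl : lam F (n + 2) ∈ (Rel F (n + 2)).concepts := mem_concepts_of_mem (Or.inl rfl)
  refine Set.Subset.antisymm ?_ ?_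
  · rintro R ⟨rfl | rfl | rfl | rfl | rfl | rfl | rfl, h⟩
    · exact absurd h hc
    · exact Or.inl rfl
    · exact Or.inr rfl
    · exact absurd (S_mem_of_congS_mem h) hS
    · exact absurd h hS
    · exact absurd h hRest
    · exact absurd (S_mem_of_delta_mem h) hS
  · rintro R (rfl | rfl)
    · exact ⟨by simp [keyRelations], (congMu_mem_iff_lam_mem hd hT hB).2 hl⟩
    · exact ⟨by simp [keyRelations], hl⟩

/-- In a geometry containing Galilean spacetime each of the other key relations, apart from being at
rest, defines lightlike relatedness. -/
theorem lam_mem_of_Gal_subset (hd : 2 ≤ d) (hG : G ⊆ insert (Bw F d) (keyRelations F d))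
    (hGal : Gal F d ⊆ G.concepts) (hR : R ∈ keyRelations F d) (h : R ∈ G.concepts)
    (h1 : R ≠ congS F d) (h2 : R ≠ S F d) (h3 : R ≠ Rest F d) : lam F d ∈ G.concepts := by
  have : NeZero d := ⟨by omega⟩
  have hT := transInv_of_subset hG
  have hB : Bw F d ∈ G.concepts := hGal (Or.inr rfl)
  have hS := S_mem_of_congS_mem (hGal (Or.inl rfl))
  rcases hR with rfl | rfl | rfl | rfl | rfl | rfl | rfl
  · exact lam_mem_of_S_mem_of_cong_mem hd hT hB hS h
  · exact (congMu_mem_iff_lam_mem hd hT hB).1 h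
  · exact h
  · exact absurd rfl h1
  · exact absurd rfl h2
  · exact absurd rfl h3
  · exact lam_mem_of_delta_mem h

theorem keyRelations_inter_Newt (hd : 2 ≤ d) :
    keyRelations F d ∩ (Newt F d).concepts = {congS F d, S F d, Rest F d} := by
  refine Set.Subset.antisymm ?_ ?_
  · rintro R ⟨hR, h⟩
    by_contra hcon
    simp only [Set.mem_insert_iff, Set.mem_singleton_iff, not_or] at hcon
    obtain ⟨n, rfl⟩ := Nat.exists_eq_add_of_le' hd
    exact Newt_not_mem (lam_mem_of_Gal_subset hd Newt_subset Gal_subset_Newt_concepts hR h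
      hcon.1 hcon.2.1 hcon.2.2)
  · have hc : congS F d ∈ (Newt F d).concepts := mem_concepts_of_mem (Or.inr (Or.inl rfl))
    rintro R (rfl | rfl | rfl)
    · exact ⟨by simp [keyRelations], hc⟩
    · exact ⟨by simp [keyRelations], S_mem_of_congS_mem hc⟩
    · exact ⟨by simp [keyRelations], mem_concepts_of_mem (Or.inl rfl)⟩

theorem keyRelations_inter_Gal (hd : 2 ≤ d) :
    keyRelations F d ∩ (Gal F d).concepts = {congS F d, S F d} := by
  refine Set.Subset.antisymm ?_ ?_
  · rintro R ⟨hR, h⟩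
    have h1 : R ∈ keyRelations F d ∩ (Newt F d).concepts :=
      ⟨hR, concepts_subset_of_subset Gal_subset_Newt_concepts h⟩
    rw [keyRelations_inter_Newt hd] at h1
    rcases h1 with h1 | h1 | rfl
    · exact Or.inl h1
    · exact Or.inr h1
    · obtain ⟨n, rfl⟩ := Nat.exists_eq_add_of_le' hd
      exact absurd h Gal_not_mem
  · have hc : congS F d ∈ (Gal F d).concepts := mem_concepts_of_mem (Or.inl rfl)
    rintro R (rfl | rfl)
    · exact ⟨by simp [keyRelations], hc⟩
    · exact ⟨by simp [keyRelations], S_mem_of_congS_mem hc⟩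

theorem Eucl_expand_defEquiv (hd : 2 ≤ d) (hR : R ∈ keyRelations F d)
    (h : R ∉ (Eucl F d).concepts) (h3 : d = 2 → R ≠ lam F d ∧ R ≠ congMu F d) :
    ((Eucl F d).expand R).DefEquiv (LClass F d) := by
  have : NeZero d := ⟨by omega⟩
  have hsub := expand_subset Eucl_subset (Set.mem_insert_of_mem _ hR)
  have hT := transInv_of_subset hsub
  have hBw : Bw F d ∈ (Eucl F d).expand R := Or.inr (Or.inr rfl)
  have hB := mem_concepts_of_mem hBw
  have hc : cong F d ∈ (Eucl F d).concepts := mem_concepts_of_mem (Or.inl rfl)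
  have hc' := concepts_subset_expand (R := R) hc
  have hR' := mem_concepts_expand (G := Eucl F d) (R := R)
  have hS : S F d ∈ ((Eucl F d).expand R).concepts := by
    rcases hR with rfl | rfl | rfl | rfl | rfl | rfl | rfl
    · exact absurd hc h
    · have hd3 : 3 ≤ d := by
        by_contra hlt
        exact (h3 (by omega)).2 rfl
      exact S_mem_of_cong_mem_of_lam_mem hd3 hT hB hc' ((congMu_mem_iff_lam_mem hd hT hB).1 hR')
    · have hd3 : 3 ≤ d := by
        by_contra hlt
        exact (h3 (by omega)).1 rfl
      exact S_mem_of_cong_mem_of_lam_mem hd3 hT hB hc' hR'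
    · exact S_mem_of_congS_mem hR'
    · exact hR'
    · exact S_mem_of_Rest_mem_of_cong_mem hd hT hB hR' hc'
    · exact S_mem_of_delta_mem hR'
  exact defEquiv_LClass hd hsub hBw hS (lam_mem_of_S_mem_of_cong_mem hd hT hB hS hc')

theorem Rel_expand_defEquiv (hd : 2 ≤ d) (hR : R ∈ keyRelations F d)
    (h : R ∉ (Rel F d).concepts) (h3 : d = 2 → R ≠ cong F d) :
    ((Rel F d).expand R).DefEquiv (LClass F d) := by
  have : NeZero d := ⟨by omega⟩
  have hsub := expand_subset Rel_subset (Set.mem_insert_of_mem _ hR)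
  have hT := transInv_of_subset hsub
  have hBw : Bw F d ∈ (Rel F d).expand R := Or.inr (Or.inr rfl)
  have hB := mem_concepts_of_mem hBw
  have hl : lam F d ∈ ((Rel F d).expand R).concepts := mem_concepts_of_mem (Or.inr (Or.inl rfl))
  have hR' := mem_concepts_expand (G := Rel F d) (R := R)
  have hmem : ∀ R' ∈ ({congMu F d, lam F d} : Set _), R' ∈ (Rel F d).concepts := by
    rw [← keyRelations_inter_Rel hd]
    exact fun _ h => h.2
  refine defEquiv_LClass hd hsub hBw ?_ hl
  rcases hR with rfl | rfl | rfl | rfl | rfl | rfl | rfl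
  · have hd3 : 3 ≤ d := by
      by_contra hlt
      exact h3 (by omega) rfl
    exact S_mem_of_cong_mem_of_lam_mem hd3 hT hB hR' hl
  · exact absurd (hmem _ (Or.inl rfl)) h
  · exact absurd (hmem _ (Or.inr rfl)) h
  · exact S_mem_of_congS_mem hR'
  · exact hR'
  · exact S_mem_of_Rest_mem_of_lam_mem hd hT hB hR' hl
  · exact S_mem_of_delta_mem hR'

/-- The expansions of Galilean and of Newtonian spacetime. -/
theorem expand_defEquiv_of_Gal_subset (hd : 2 ≤ d) (hG : G ⊆ insert (Bw F d) (keyRelations F d))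
    (hGal : Gal F d ⊆ G) (hR : R ∈ keyRelations F d) (h : R ∉ G.concepts) (h3 : R ≠ Rest F d) :
    (G.expand R).DefEquiv (LClass F d) := by
  have hsub := expand_subset hG (Set.mem_insert_of_mem _ hR)
  have hGal' : Gal F d ⊆ G.expand R := hGal.trans fun _ h => Or.inr h
  have hcS : congS F d ∈ G.concepts := mem_concepts_of_mem (hGal (Or.inl rfl))
  have : NeZero d := ⟨by omega⟩
  refine defEquiv_LClass hd hsub (hGal' (Or.inr rfl))
    (S_mem_of_congS_mem (concepts_subset_expand hcS))
    (lam_mem_of_Gal_subset hd hsub (hGal'.trans fun _ h => mem_concepts_of_mem h) hR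
      mem_concepts_expand ?_ ?_ h3)
  · rintro rfl
    exact h hcS
  · rintro rfl
    exact h (S_mem_of_congS_mem hcS)

theorem OAff_expand_delta_defEquiv (hd : 2 ≤ d) :
    ((OAff F d).expand (delta F d)).DefEquiv (LClass F d) := by
  have : NeZero d := ⟨by omega⟩
  refine defEquiv_LClass hd ?_ (Or.inr rfl) (S_mem_of_delta_mem mem_concepts_expand)
    (lam_mem_of_delta_mem mem_concepts_expand)
  rintro R (rfl | rfl) <;> simp [keyRelations]

theorem Eucl_expand_congMu_defEquiv (hd : 2 ≤ d) :
    ((Eucl F d).expand (congMu F d)).DefEquiv ((Eucl F d).expand (lam F d)) := by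
  have : NeZero d := ⟨by omega⟩
  have key (R : FinRel (Point F d)) (hR : R ∈ keyRelations F d) :
      congMu F d ∈ ((Eucl F d).expand R).concepts ↔ lam F d ∈ ((Eucl F d).expand R).concepts :=
    congMu_mem_iff_lam_mem hd
      (transInv_of_subset (expand_subset Eucl_subset (Set.mem_insert_of_mem _ hR)))
      (mem_concepts_of_mem (Or.inr (Or.inr rfl)))
  refine defEquiv_of_subset (Set.insert_subset ?_ fun _ h => mem_concepts_of_mem (Or.inr h))
    (Set.insert_subset ?_ fun _ h => mem_concepts_of_mem (Or.inr h))
  · exact (key _ (by simp [keyRelations])).2 mem_concepts_expand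
  · exact (key _ (by simp [keyRelations])).1 mem_concepts_expand

theorem not_Eucl_expand_lam_defEquiv :
    ¬ ((Eucl F 2).expand (lam F 2)).DefEquiv (LClass F 2) := by
  intro h
  refine Eucl_expand_lam_not_mem (F := F) ?_
  rw [show ((Eucl F 2).expand (lam F 2)).concepts = _ from h]
  exact S_mem_of_congS_mem (mem_concepts_of_mem (Or.inr (Or.inl rfl)))

end Classification

end CoordGeom

open CoordGeom in
theorem mainTheorem3 {F : Type*} [Field F] [LinearOrder F] [IsStrictOrderedRing F]
    (d : ℕ) (hd : 2 ≤ d) :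
    -- which of the key relations are concepts of which geometry
    (keyRelations F d ∩ (Eucl F d).concepts = {cong F d} ∧
      keyRelations F d ∩ (Rel F d).concepts = {congMu F d, lam F d} ∧
      keyRelations F d ∩ (Gal F d).concepts = {congS F d, S F d} ∧
      keyRelations F d ∩ (Newt F d).concepts = {congS F d, S F d, Rest F d}) ∧
    -- expansions of the four geometries by a key relation that is not a concept of them
    (∀ G ∈ ({Rel F d, Eucl F d, Gal F d, Newt F d} : Set (Model (Point F d))),
      ∀ R ∈ keyRelations F d, R ∉ G.concepts → (G = Gal F d → R ≠ Rest F d) →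
        (3 ≤ d → (G.expand R).DefEquiv (LClass F d)) ∧
        (d = 2 →
          ¬ (G = Eucl F d ∧ R = lam F d) → ¬ (G = Eucl F d ∧ R = congMu F d) →
          ¬ (G = Rel F d ∧ R = cong F d) →
          (G.expand R).DefEquiv (LClass F d))) ∧
    -- the exceptional expansions in dimension two
    (d = 2 →
      ((Rel F d).expand (cong F d)).DefEquiv ((Eucl F d).expand (congMu F d)) ∧
      ((Eucl F d).expand (congMu F d)).DefEquiv ((Eucl F d).expand (lam F d)) ∧
      ((Rel F d).expand (cong F d)).DefEquiv ((Eucl F d).expand (lam F d)) ∧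
      ¬ ((Rel F d).expand (cong F d)).DefEquiv (LClass F d) ∧
      ¬ ((Eucl F d).expand (congMu F d)).DefEquiv (LClass F d) ∧
      ¬ ((Eucl F d).expand (lam F d)).DefEquiv (LClass F d)) ∧
    -- the expansion of ordered affine geometry
    ((OAff F d).expand (delta F d)).DefEquiv (LClass F d) := by
  refine ⟨⟨keyRelations_inter_Eucl hd, keyRelations_inter_Rel hd, keyRelations_inter_Gal hd,
    keyRelations_inter_Newt hd⟩, ?_, ?_, OAff_expand_delta_defEquiv hd⟩
  · rintro G (rfl | rfl | rfl | rfl) R hR h hG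
    -- the condition on dimension two is void for `3 ≤ d`
    · exact ⟨fun hd3 => Rel_expand_defEquiv hd hR h (by omega), fun _ _ _ h3 =>
        Rel_expand_defEquiv hd hR h fun _ hR' => h3 ⟨rfl, hR'⟩⟩
    · exact ⟨fun hd3 => Eucl_expand_defEquiv hd hR h (by omega), fun _ h1 h2 _ =>
        Eucl_expand_defEquiv hd hR h fun _ =>
          ⟨fun hR' => h1 ⟨rfl, hR'⟩, fun hR' => h2 ⟨rfl, hR'⟩⟩⟩
    · have heq := expand_defEquiv_of_Gal_subset hd Gal_subset subset_rfl hR h (hG rfl)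
      exact ⟨fun _ => heq, fun _ _ _ _ => heq⟩
    · have heq := expand_defEquiv_of_Gal_subset hd Newt_subset (fun _ h => Or.inr h) hR h (by
        rintro rfl
        exact h (Model.mem_concepts_of_mem (Or.inl rfl)))
      exact ⟨fun _ => heq, fun _ _ _ _ => heq⟩
  · rintro rfl
    have h1 := Eucl_expand_congMu_defEquiv (F := F) hd
    have h2 := not_Eucl_expand_lam_defEquiv (F := F)
    rw [Rel_expand_cong_eq]
    exact ⟨h1.symm, h1, rfl, h2, fun h => h2 (h1.symm.trans h), h2⟩
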